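/- Let $n\ge 2$, let $(M^n,g)$ be a compact smooth Riemannian manifold with nonempty boundary, let $m>0$, $\phi\in C^\infty(M)$, and define $v>0$ by $v^m=e^{-\phi}$. Let $dV_g$, $d\sigma_g$ be the Riemannian volume measures of $M$ and $\partial M$; all integrals below are taken with respect to $v^m dV_g$ on $M$ and $v^m d\sigma_g$ on $\partial M$. Let $\eta$ be the outer unit normal, $R_g$ the scalar curvature, $H_g$ the trace of the second fundamental form of $\partial M$ with respect to $\eta$ (positive for a Euclidean ball), and put $$R^m_\phi=R_g+2\Delta_g\phi-\tfrac{m+1}{m}|\nabla\phi|^2,\qquad H^m_\phi=H_g+\tfrac{\partial\phi}{\partial\eta},\qquad p=\tfrac{2(m+n-1)}{m+n-2}.$$ Let $H^1(M)$ be the closure of $C^\infty(M)$ in the norm given by $\int_M|\nabla w|^2+w^2$, its elements being restricted to $\partial M$ in the sense of traces. For $w\in H^1(M)$ and $\tau>0$ set $$A(w)=\int_M\Big(|\nabla w|^2+\tfrac{m+n-2}{4(m+n-1)}R^m_\phi w^2\Big)+\int_{\partial M}\tfrac{m+n-2}{2(m+n-1)}H^m_\phi w^2,\quad B(w)=\int_M|w|^p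 v^{-1},\quad S(w)=\int_{\partial M}|w|^p,$$ $$\mathcal Q(w)=\frac{A(w)\,B(w)^{\frac{m}{m+n-1}}}{S(w)^{\frac{2m+n-2}{m+n-1}}},\qquad \mathcal W(w,\tau)=\tau^{\frac{m}{2(m+n-1)}}A(w)+\tau^{-\frac12}B(w)-S(w).$$ Let $\Lambda=\inf\{\mathcal Q(w): w\in H^1(M),\ S(w)\neq0\}$, $\nu(\tau)=\inf\{\mathcal W(w,\tau): w\in H^1(M),\ S(w)=1\}$ and $\nu=\inf_{\tau>0}\nu(\tau)$, with values in $\mathbb R\cup\{-\infty\}$. Then: 1. $\Lambda\in[-\infty,0)$ if and only if $\nu=-\infty$; 2. $\Lambda=0$ if and only if $\nu=-1$; 3. $\Lambda>0$ if and only if $\nu>-1$. Moreover, in this case $$\nu=\frac{2m+n-1}{m}\left[\frac{m\Lambda}{m+n-1}\right]^{\frac{m+n-1}{2m+n-1}}-1,$$ and, for $w\in H^1(M)$, $w$ is a volume-normalized minimizer of $\Lambda$ (that is, $S(w)=1$ and $\mathcal Q(w)=\Lambda$) if and only if $(w,\tau)$ is a volume-normalized minimizer of $\nu$ (that is, $\tau>0$,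 $S(w)=1$ and $\mathcal W(w,\tau)=\nu$) for $$\tau=\left[\frac{(m+n-1)\,B(w)}{m\,A(w)}\right]^{\frac{2(m+n-1)}{2m+n-1}};$$ and if $(w,\tau)$ is a volume-normalized minimizer of $\nu$, then $\tau$ necessarily has this value. -/

import Mathlib

open MeasureTheory Set Filter Topology
open scoped Manifold ContDiff

noncomputable section

namespace EscobarWeighted

/-! ### Riemannian metrics on manifolds with boundary, in charts -/

section Riemannian

/-- Smooth Riemannian metrics on an `n`-dimensional manifold with (possibly empty) boundary,
modelled on the half-space `{x : x 0 ≥ 0}` of Euclidean `n`-space. -/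
abbrev Metric (n : ℕ) [NeZero n] (M : Type*) [TopologicalSpace M]
    [ChartedSpace (EuclideanHalfSpace n) M] [IsManifold (𝓡∂ n) ∞ M] :=
  Bundle.ContMDiffRiemannianMetric (𝓡∂ n) ∞ (EuclideanSpace ℝ (Fin n))
    (fun p : M => TangentSpace (𝓡∂ n) p)

/-- Smooth real functions on `M` (smooth up to the boundary). -/
abbrev IsSmooth (n : ℕ) [NeZero n] {M : Type*} [TopologicalSpace M]
    [ChartedSpace (EuclideanHalfSpace n) M] (u : M → ℝ) : Prop :=
  ContMDiff (𝓡∂ n) 𝓘(ℝ, ℝ) ∞ u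

variable {n : ℕ} [NeZero n] {M : Type*} [TopologicalSpace M]
  [ChartedSpace (EuclideanHalfSpace n) M] [IsManifold (𝓡∂ n) ∞ M]

/-- The partial derivative `∂_k f` at `y` of a function on the half-space (one-sided in the
direction normal to the boundary when `y` lies on the boundary). -/
def pd (k : Fin n) (f : EuclideanSpace ℝ (Fin n) → ℝ) (y : EuclideanSpace ℝ (Fin n)) : ℝ :=
  fderivWithin ℝ f (range (𝓡∂ n)) y (EuclideanSpace.single k 1)

/-- The coordinate vector field `∂_i` of the chart at `a`, at the point with coordinates `y`. -/
def coordVec (a : M) (y : EuclideanSpace ℝ (Fin n)) (i : Fin n) :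
    TangentSpace (𝓡∂ n) ((extChartAt (𝓡∂ n) a).symm y) :=
  mfderivWithin 𝓘(ℝ, EuclideanSpace ℝ (Fin n)) (𝓡∂ n) (extChartAt (𝓡∂ n) a).symm
    (range (𝓡∂ n)) y (EuclideanSpace.single i (1 : ℝ))

/-- The matrix `g_ij` of the metric in the chart at `a`, at the point with coordinates `y`. -/
def gram (g : Metric n M) (a : M) (y : EuclideanSpace ℝ (Fin n)) : Matrix (Fin n) (Fin n) ℝ :=
  Matrix.of fun i j =>
    g.inner ((extChartAt (𝓡∂ n) a).symm y) (coordVec a y i) (coordVec a y j)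

/-- The inverse matrix `g^ij`. -/
def gramInv (g : Metric n M) (a : M) (y : EuclideanSpace ℝ (Fin n)) :
    Matrix (Fin n) (Fin n) ℝ := (gram g a y)⁻¹

/-- The matrix of the metric induced on the boundary `{x 0 = 0}`, in the coordinates `x i`,
`i ≠ 0`. -/
def bdGram (g : Metric n M) (a : M) (y : EuclideanSpace ℝ (Fin n)) :
    Matrix {i : Fin n // i ≠ 0} {i : Fin n // i ≠ 0} ℝ :=
  Matrix.of fun i j => gram g a y i j

/-- The Christoffel symbols `Γ^k_ij` of the Levi-Civita connection in the chart at `a`. -/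
def christoffel (g : Metric n M) (a : M) (k i j : Fin n) (y : EuclideanSpace ℝ (Fin n)) : ℝ :=
  (1 / 2) * ∑ l, gramInv g a y k l *
    (pd i (fun z => gram g a z j l) y + pd j (fun z => gram g a z i l) y
      - pd l (fun z => gram g a z i j) y)

/-- The Ricci tensor `R_ij = ∂_k Γ^k_ij - ∂_j Γ^k_ik + Γ^k_kl Γ^l_ij - Γ^k_jl Γ^l_ik` in the chart
at `a`. -/
def ricci (g : Metric n M) (a : M) (i j : Fin n) (y : EuclideanSpace ℝ (Fin n)) : ℝ :=
  ∑ k, (pd k (christoffel g a k i j) y - pd j (christoffel g a k i k) y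
    + ∑ l, (christoffel g a k k l y * christoffel g a l i j y
        - christoffel g a k j l y * christoffel g a l i k y))

/-- The scalar curvature `R_g`, computed at `p` in the chart at `p` (the value does not depend on
the chart). -/
def scalarCurvature (g : Metric n M) (p : M) : ℝ :=
  ∑ i, ∑ j, gramInv g p (extChartAt (𝓡∂ n) p p) i j * ricci g p i j (extChartAt (𝓡∂ n) p p)

/-- The Laplacian `Δ_g u = g^ij (∂_i ∂_j u - Γ^k_ij ∂_k u)`, computed at `p` in the chart at `p`. -/
def laplacian (g : Metric n M) (u : M → ℝ) (p : M) : ℝ :=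
  ∑ i, ∑ j, gramInv g p (extChartAt (𝓡∂ n) p p) i j *
    (pd i (pd j (u ∘ (extChartAt (𝓡∂ n) p).symm)) (extChartAt (𝓡∂ n) p p)
      - ∑ k, christoffel g p k i j (extChartAt (𝓡∂ n) p p) *
          pd k (u ∘ (extChartAt (𝓡∂ n) p).symm) (extChartAt (𝓡∂ n) p p))

/-- The matrix of the metric on `T_p M` in the standard basis; in Mathlib `T_p M` is the model
vector space, identified through the chart at `p`. -/
def fiberGram (g : Metric n M) (p : M) : Matrix (Fin n) (Fin n) ℝ :=
  Matrix.of fun i j => g.inner p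
    ((EuclideanSpace.single i (1 : ℝ) : EuclideanSpace ℝ (Fin n)) : TangentSpace (𝓡∂ n) p)
    ((EuclideanSpace.single j (1 : ℝ) : EuclideanSpace ℝ (Fin n)) : TangentSpace (𝓡∂ n) p)

/-- The squared length `|X|_g²` of a tangent vector. -/
def normSq (g : Metric n M) (p : M) (X : TangentSpace (𝓡∂ n) p) : ℝ := g.inner p X X

/-- The differential of `u` at `p`. -/
def diff (u : M → ℝ) (p : M) (X : TangentSpace (𝓡∂ n) p) : ℝ :=
  mfderiv (𝓡∂ n) 𝓘(ℝ, ℝ) u p X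

/-- The gradient `∇u = g^ij ∂_i u ∂_j`. -/
def gradient (g : Metric n M) (u : M → ℝ) (p : M) : TangentSpace (𝓡∂ n) p :=
  (∑ j, (∑ i, (fiberGram g p)⁻¹ i j * diff (n := n) u p (EuclideanSpace.single i (1 : ℝ))) •
    (EuclideanSpace.single j (1 : ℝ)) : EuclideanSpace ℝ (Fin n))

/-- The components `η^k = - g^0k / √(g^00)` of the outer unit normal of the boundary `{x 0 = 0}`
(extended to the chart domain as the unit normal of the level sets of the coordinate `x 0`, which
is positive in the interior). -/
def normalCoord (g : Metric n M) (a : M) (k : Fin n) (y : EuclideanSpace ℝ (Fin n)) : ℝ :=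
  - gramInv g a y 0 k / Real.sqrt (gramInv g a y 0 0)

/-- The second fundamental form `h_ij = g(∇_{∂_i} η, ∂_j)` with respect to the outer unit
normal. -/
def secondFundamentalForm (g : Metric n M) (a : M) (i j : Fin n)
    (y : EuclideanSpace ℝ (Fin n)) : ℝ :=
  ∑ k, gram g a y k j *
    (pd i (normalCoord g a k) y + ∑ l, christoffel g a k i l y * normalCoord g a l y)

/-- The trace `H_g` of the second fundamental form of the boundary with respect to the induced
metric, at a boundary point `p`, computed in the chart at `p`. It is positive for the ball. -/
def boundaryMeanCurvature (g : Metric n M) (p : M) : ℝ :=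
  ∑ i : {i : Fin n // i ≠ 0}, ∑ j : {i : Fin n // i ≠ 0},
    (bdGram g p (extChartAt (𝓡∂ n) p p))⁻¹ i j *
      secondFundamentalForm g p i j (extChartAt (𝓡∂ n) p p)

/-- The outer normal derivative `∂u/∂η` at a boundary point `p`. -/
def normalDeriv (g : Metric n M) (u : M → ℝ) (p : M) : ℝ :=
  ∑ k, normalCoord g p k (extChartAt (𝓡∂ n) p p) *
    pd k (u ∘ (extChartAt (𝓡∂ n) p).symm) (extChartAt (𝓡∂ n) p p)

end Riemannian

/-! ### The volume measures of `M` and of its boundary -/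

section Volume

/-- The point of the boundary hyperplane `{x 0 = 0}` with the given other coordinates. -/
def bdPoint {n : ℕ} [NeZero n] (z : {i : Fin n // i ≠ 0} → ℝ) : EuclideanSpace ℝ (Fin n) :=
  WithLp.toLp 2 fun i => if h : i = 0 then 0 else z ⟨i, h⟩

variable {n : ℕ} [NeZero n] {M : Type*} [TopologicalSpace M]
  [ChartedSpace (EuclideanHalfSpace n) M] [IsManifold (𝓡∂ n) ∞ M]
  [MeasurableSpace M] [BorelSpace M]

/-- The volume measure `√(det g_ij) dx` on the domain of the chart at `a`. -/
def chartVolume (g : Metric n M) (a : M) : Measure M :=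
  Measure.map (extChartAt (𝓡∂ n) a).symm
    ((volume.restrict (extChartAt (𝓡∂ n) a).target).withDensity
      fun y => ENNReal.ofReal (Real.sqrt (gram g a y).det))

/-- The volume measure of the boundary (for the induced metric) on the domain of the chart at `a`,
as a measure on `M` carried by the boundary. -/
def chartArea (g : Metric n M) (a : M) : Measure M :=
  Measure.map (fun z => (extChartAt (𝓡∂ n) a).symm (bdPoint z))
    ((volume.restrict {z | bdPoint z ∈ (extChartAt (𝓡∂ n) a).target}).withDensity
      fun z => ENNReal.ofReal (Real.sqrt (bdGram g a (bdPoint z)).det))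

variable [T2Space M] [CompactSpace M]

variable (n M) in
/-- A smooth partition of unity subordinate to the chart domains. -/
def chartPartition : SmoothPartitionOfUnity M (𝓡∂ n) M univ :=
  (SmoothPartitionOfUnity.exists_isSubordinate_chartAt_source (𝓡∂ n) M).choose

/-- The Riemannian volume measure `dV_g`, glued from the charts with a partition of unity (by the
change of variables formula, it does not depend on the partition). -/
def riemVolume (g : Metric n M) : Measure M :=
  Measure.sum fun a : M =>
    (chartVolume g a).withDensity fun p => ENNReal.ofReal (chartPartition n M a p)

/-- The Riemannian volume measure `dσ_g` of the boundary, as a measure on `M` carried by the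
boundary. -/
def riemArea (g : Metric n M) : Measure M :=
  Measure.sum fun a : M =>
    (chartArea g a).withDensity fun p => ENNReal.ofReal (chartPartition n M a p)

end Volume

/-! ### Smooth metric measure spaces with boundary -/

/-- The data `(M, g, e^{-φ} dV_g, e^{-φ} dσ_g, m)` of a smooth metric measure space. -/
structure SmoothMMS (n : ℕ) [NeZero n] (M : Type*) [TopologicalSpace M]
    [ChartedSpace (EuclideanHalfSpace n) M] [IsManifold (𝓡∂ n) ∞ M] where
  g : Metric n M
  φ : M → ℝ
  φ_smooth : IsSmooth n φ
  m : ℝ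
  m_nonneg : 0 ≤ m
  φ_eq_zero : m = 0 → φ = 0

namespace SmoothMMS

variable {n : ℕ} [NeZero n] {M : Type*} [TopologicalSpace M]
  [ChartedSpace (EuclideanHalfSpace n) M] [IsManifold (𝓡∂ n) ∞ M]

/-- The function `v` with `v^m = e^{-φ}` (and `v = 1` when `m = 0`). -/
def v (X : SmoothMMS n M) (p : M) : ℝ := Real.exp (-(X.φ p) / X.m)

/-- The weighted scalar curvature `R_g + 2 Δφ - ((m+1)/m) |∇φ|²` (equal to `R_g` if `m = 0`). -/
def weightedScalar (X : SmoothMMS n M) (p : M) : ℝ :=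
  scalarCurvature X.g p + 2 * laplacian X.g X.φ p
    - (X.m + 1) / X.m * normSq X.g p (gradient X.g X.φ p)

/-- The Gromov mean curvature `H_g + ∂φ/∂η` of the boundary. -/
def weightedMean (X : SmoothMMS n M) (p : M) : ℝ :=
  boundaryMeanCurvature X.g p + normalDeriv X.g X.φ p

/-- The exponent `2(m+n-1)/(m+n-2)`. -/
def crit (X : SmoothMMS n M) : ℝ := 2 * (X.m + n - 1) / (X.m + n - 2)

variable [MeasurableSpace M] [BorelSpace M] [T2Space M] [CompactSpace M]

/-- The measure `v^m dV_g = e^{-φ} dV_g`. -/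
def vol (X : SmoothMMS n M) : Measure M :=
  (riemVolume X.g).withDensity fun p => ENNReal.ofReal (Real.exp (-(X.φ p)))

/-- The measure `v^m dσ_g = e^{-φ} dσ_g` on the boundary. -/
def area (X : SmoothMMS n M) : Measure M :=
  (riemArea X.g).withDensity fun p => ENNReal.ofReal (Real.exp (-(X.φ p)))

/-- An element of the Sobolev space `H¹(M, v^m dV_g, v^m dσ_g)`, the closure of `C^∞(M)` in the
norm `∫ |∇w|² + w²`: a function `w` on `M` with its weak gradient `grad` and its trace on `∂M`
(the values of `trace` away from `∂M` are irrelevant), which are the `L²` limits of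
`u k`, `∇ (u k)` and `u k` restricted to `∂M` for a sequence of smooth functions `u k`.
The exponent `crit` is at most critical for the Sobolev and trace embeddings, so the two
integrability conditions on `w` and its trace exclude nothing: they fix that all
integrals below are finite. -/
structure H1 (X : SmoothMMS n M) where
  w : M → ℝ
  grad : ∀ p : M, TangentSpace (𝓡∂ n) p
  trace : M → ℝ
  memLp : MemLp w (ENNReal.ofReal X.crit) X.vol
  memLp_trace : MemLp trace (ENNReal.ofReal X.crit) X.area
  /-- `grad` is a measurable vector field. -/
  grad_meas : ∀ f : M → ℝ, IsSmooth n f →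
    AEStronglyMeasurable (fun p => diff (n := n) f p (grad p)) X.vol
  exists_approx : ∃ u : ℕ → M → ℝ, (∀ k, IsSmooth n (u k)) ∧
    Tendsto (fun k => eLpNorm (fun p => u k p - w p) 2 X.vol) atTop (𝓝 0) ∧
    Tendsto (fun k => ∫⁻ p, ENNReal.ofReal (normSq X.g p (gradient X.g (u k) p - grad p)) ∂X.vol)
      atTop (𝓝 0) ∧
    Tendsto (fun k => eLpNorm (fun p => u k p - trace p) 2 X.area) atTop (𝓝 0)

/-- The quadratic form `(L w, w) + (B w, w)` of the weighted conformal Laplacian, in the form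
`∫_M (|∇w|² + (m+n-2)/(4(m+n-1)) R w²) + ∫_∂M (m+n-2)/(2(m+n-1)) H w²` that makes sense
on `H¹`. -/
def energyForm (X : SmoothMMS n M) (w : X.H1) : ℝ :=
  (∫ p, (normSq X.g p (w.grad p)
      + (X.m + n - 2) / (4 * (X.m + n - 1)) * X.weightedScalar p * w.w p ^ 2) ∂X.vol)
    + ∫ p, (X.m + n - 2) / (2 * (X.m + n - 1)) * X.weightedMean p * w.trace p ^ 2 ∂X.area

/-- `∫_M |w|^{2(m+n-1)/(m+n-2)} v⁻¹`. -/
def interiorInt (X : SmoothMMS n M) (w : X.H1) : ℝ :=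
  ∫ p, |w.w p| ^ X.crit * (X.v p)⁻¹ ∂X.vol

/-- `∫_∂M |w|^{2(m+n-1)/(m+n-2)}`. -/
def boundaryInt (X : SmoothMMS n M) (w : X.H1) : ℝ :=
  ∫ p, |w.trace p| ^ X.crit ∂X.area

/-- The weighted Escobar quotient. -/
def quotient (X : SmoothMMS n M) (w : X.H1) : ℝ :=
  X.energyForm w * X.interiorInt w ^ (X.m / (X.m + n - 1))
    / X.boundaryInt w ^ ((2 * X.m + n - 2) / (X.m + n - 1))

/-- The weighted Escobar constant `Λ`, the infimum of the quotient over all `w` for which it is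
defined, that is, whose trace on the boundary does not vanish. -/
def escobarConstant (X : SmoothMMS n M) : EReal :=
  ⨅ (w : X.H1) (_ : X.boundaryInt w ≠ 0), (X.quotient w : EReal)

/-- The `W`-functional. -/
def WFunctional (X : SmoothMMS n M) (w : X.H1) (τ : ℝ) : ℝ :=
  τ ^ (X.m / (2 * (X.m + n - 1))) * X.energyForm w
    + τ ^ (-(1 / 2) : ℝ) * X.interiorInt w - X.boundaryInt w

/-- The `τ`-energy `ν(τ)`. -/
def tauEnergy (X : SmoothMMS n M) (τ : ℝ) : EReal :=
  ⨅ (w : X.H1) (_ : X.boundaryInt w = 1), (X.WFunctional w τ : EReal)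

/-- The energy `ν = inf_{τ > 0} ν(τ)`. -/
def energy (X : SmoothMMS n M) : EReal :=
  ⨅ (τ : ℝ) (_ : 0 < τ), X.tauEnergy τ

/-- `w` is a volume-normalized minimizer of the weighted Escobar constant. -/
def IsEscobarMinimizer (X : SmoothMMS n M) (w : X.H1) : Prop :=
  X.boundaryInt w = 1 ∧ (X.quotient w : EReal) = X.escobarConstant

/-- `(w, τ)` is a volume-normalized minimizer of the energy. -/
def IsEnergyMinimizer (X : SmoothMMS n M) (w : X.H1) (τ : ℝ) : Prop :=
  0 < τ ∧ X.boundaryInt w = 1 ∧ (X.WFunctional w τ : EReal) = X.energy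

/-- The value of `τ` attached to `w`. -/
def optimalTau (X : SmoothMMS n M) (w : X.H1) : ℝ :=
  ((X.m + n - 1) * X.interiorInt w / (X.m * X.energyForm w))
    ^ (2 * (X.m + n - 1) / (2 * X.m + n - 1))

end SmoothMMS

end EscobarWeighted

end

set_option linter.unusedSectionVars false

open MeasureTheory Set Filter Topology
open scoped Manifold ContDiff

noncomputable section

/-! Write N = m + n - 1. Under w ↦ c w with c > 0 the quotient is invariant and S can be normalized
to 1, so Λ is the infimum of A B^(m/N) over S = 1. On the same set W = τ^(m/(2N)) A + τ^(-1/2) B -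
1, and τ can be minimized away for each w separately, provided B > 0.

If A > 0, there is a unique minimum in τ, with value `minValue m N (A * B ^ (m / N))`, a function of
the quotient alone. If A = 0, the infimum is -1, approached as τ → ∞ but not attained. If A < 0,
letting τ → ∞ gives -∞. As `minValue m N` is continuous and strictly increasing on [0, ∞) with value
-1 at 0, it commutes with the infimum over w. This gives the trichotomy and the formula for ν.
Strict monotonicity and uniqueness of the optimal τ match the minimizers. The lemmas are
`minPoint_balance`, `minValue_lt`, `iInf_eq_bot_of_neg` and `iInf_eq_minValue`.

The analytic input is that S(w) ≠ 0 forces B(w) > 0 (`SmoothMMS.interiorInt_pos`): an element of H¹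
that vanishes almost everywhere inside has zero trace. For smooth u and a partition function ρ
supported in a chart, integrating the inward coordinate derivative of (ρu)² from the boundary bounds
its boundary integral by a multiple of ∫ (u² + |u| |ρ ∂₀u|). Along an approximating sequence u tends
to 0 in L² while the localized derivatives stay bounded in L², so the bound tends to 0 and the trace
vanishes. Nothing needs to be known about the limit of the gradients.

The normalized class is nonempty because the constant 1 has S ≠ 0: the boundary measure is nonzero
as soon as the boundary is nonempty (`riemArea_ne_zero`). -/

namespace EscobarWeighted

/-! ### Coordinate frames, Gram matrices and the gradient. -/

section Frames

variable {n : ℕ} [NeZero n] {M : Type*} [TopologicalSpace M]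
  [ChartedSpace (EuclideanHalfSpace n) M] [IsManifold (𝓡∂ n) ∞ M]

/-- The `i`-th coordinate vector field of the chart at `a`, as a vector field on the chart domain. -/
def chartFrame (a p : M) (i : Fin n) : TangentSpace (𝓡∂ n) p :=
  (trivializationAt (EuclideanSpace ℝ (Fin n)) (TangentSpace (𝓡∂ n)) a).symmL ℝ p
    (EuclideanSpace.single i (1 : ℝ))

lemma chartFrame_eq {a p : M} (hp : p ∈ (chartAt (EuclideanHalfSpace n) a).source) (i : Fin n) :
    chartFrame a p i = mfderivWithin 𝓘(ℝ, EuclideanSpace ℝ (Fin n)) (𝓡∂ n)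
      (extChartAt (𝓡∂ n) a).symm (range (𝓡∂ n)) (extChartAt (𝓡∂ n) a p)
      (EuclideanSpace.single i (1 : ℝ)) := by
  have : IsManifold (𝓡∂ n) 1 M := IsManifold.of_le (n := ∞) (by norm_cast)
  have := TangentBundle.symmL_trivializationAt (I := 𝓡∂ n) (𝕜 := ℝ) hp
  unfold chartFrame
  rw [this]
  rfl

/-- Passing to the trivialization of the tangent bundle makes the continuity of the Gram matrix a
statement about continuous sections. -/
lemma coordVec_eq_chartFrame {a : M} {y : EuclideanSpace ℝ (Fin n)}
    (hy : y ∈ (extChartAt (𝓡∂ n) a).target) (i : Fin n) :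
    coordVec a y i = chartFrame a ((extChartAt (𝓡∂ n) a).symm y) i := by
  rw [chartFrame_eq, (extChartAt (𝓡∂ n) a).right_inv hy]
  · rfl
  · rw [← extChartAt_source (𝓡∂ n)]; exact (extChartAt (𝓡∂ n) a).map_target hy

lemma gram_eq (g : Metric n M) {a : M} {y : EuclideanSpace ℝ (Fin n)}
    (hy : y ∈ (extChartAt (𝓡∂ n) a).target) (i j : Fin n) :
    gram g a y i j = g.inner ((extChartAt (𝓡∂ n) a).symm y)
      (chartFrame a ((extChartAt (𝓡∂ n) a).symm y) i)
      (chartFrame a ((extChartAt (𝓡∂ n) a).symm y) j) := by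
  rw [gram, Matrix.of_apply, coordVec_eq_chartFrame hy, coordVec_eq_chartFrame hy]

lemma continuousOn_chartFrame (a : M) (i : Fin n) :
    ContinuousOn (fun p => Bundle.TotalSpace.mk' (EuclideanSpace ℝ (Fin n))
      (E := fun p : M => TangentSpace (𝓡∂ n) p) p (chartFrame a p i))
      (chartAt (EuclideanHalfSpace n) a).source := by
  have h := (trivializationAt (EuclideanSpace ℝ (Fin n))
    (TangentSpace (𝓡∂ n)) a).continuousOn_symm.comp
    (f := fun p : M => (p, EuclideanSpace.single i (1 : ℝ)))
    (s := (chartAt (EuclideanHalfSpace n) a).source) (by fun_prop) (fun p hp => by simpa using hp)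
  refine h.congr fun p hp => ?_
  simp only [Function.comp_apply, chartFrame]
  rw [Bundle.Trivialization.symmL_apply (R := ℝ) _ (by simpa using hp)]

lemma continuousOn_inner_chartFrame (g : Metric n M) (a : M) (i j : Fin n) :
    ContinuousOn (fun p => g.inner p (chartFrame a p i) (chartFrame a p j))
      (chartAt (EuclideanHalfSpace n) a).source := by
  intro p hp
  have h := ContinuousWithinAt.clm_bundle_apply₂ (F₁ := EuclideanSpace ℝ (Fin n))
    (F₂ := EuclideanSpace ℝ (Fin n)) (F₃ := ℝ)
    (E₁ := fun p : M => TangentSpace (𝓡∂ n) p) (E₂ := fun p : M => TangentSpace (𝓡∂ n) p)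
    (E₃ := Bundle.Trivial M ℝ) (b := fun p : M => p)
    (ψ := fun p => g.inner p) (v := fun p => chartFrame a p i) (w := fun p => chartFrame a p j)
    (g.contMDiff.continuous.continuousAt.continuousWithinAt (s := (chartAt (EuclideanHalfSpace n) a).source))
    (continuousOn_chartFrame a i p hp) (continuousOn_chartFrame a j p hp)
  simp only [FiberBundle.continuousWithinAt_totalSpace] at h
  exact h.2

lemma continuousOn_gram (g : Metric n M) (a : M) :
    ContinuousOn (gram g a) (extChartAt (𝓡∂ n) a).target := by
  refine continuousOn_pi.2 fun i => continuousOn_pi.2 fun j => ?_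
  have h := (continuousOn_inner_chartFrame g a i j).comp (continuousOn_extChartAt_symm a)
    (fun y hy => by rw [← extChartAt_source (𝓡∂ n)]; exact (extChartAt (𝓡∂ n) a).map_target hy)
  exact h.congr fun y hy => gram_eq g hy i j

lemma sum_smul_chartFrame (a p : M)
    (x : EuclideanSpace ℝ (Fin n)) :
    ∑ i, x i • chartFrame a p i =
      (trivializationAt (EuclideanSpace ℝ (Fin n)) (TangentSpace (𝓡∂ n)) a).symmL ℝ p x := by
  conv_rhs => rw [← (EuclideanSpace.basisFun (Fin n) ℝ).sum_repr x]
  simp only [map_sum, map_smul, chartFrame]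
  simp

lemma symmL_injective {a p : M} (hp : p ∈ (chartAt (EuclideanHalfSpace n) a).source) :
    Function.Injective
      ((trivializationAt (EuclideanSpace ℝ (Fin n)) (TangentSpace (𝓡∂ n)) a).symmL ℝ p) := by
  intro x y hxy
  have hb : p ∈ (trivializationAt (EuclideanSpace ℝ (Fin n)) (TangentSpace (𝓡∂ n)) a).baseSet := by
    simpa using hp
  rw [← Bundle.Trivialization.continuousLinearMapAt_symmL (R := ℝ) _ hb x, hxy,
    Bundle.Trivialization.continuousLinearMapAt_symmL (R := ℝ) _ hb y]

/-- The Gram matrix of a linearly independent family for a Riemannian metric is positive definite. -/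
lemma posDef_of_inner (g : Metric n M) (p : M) (T : EuclideanSpace ℝ (Fin n) →L[ℝ] TangentSpace (𝓡∂ n) p)
    (hT : Function.Injective T) :
    (Matrix.of fun i j => g.inner p (T (EuclideanSpace.single i (1 : ℝ)))
      (T (EuclideanSpace.single j (1 : ℝ)))).PosDef := by
  refine Matrix.PosDef.of_dotProduct_mulVec_pos ?_ ?_
  · ext i j
    simp [Matrix.conjTranspose_apply, g.symm p (T (EuclideanSpace.single i (1 : ℝ)))]
  · intro x hx
    have h0 : T (WithLp.toLp 2 x) ≠ 0 := by
      rw [Ne, map_eq_zero_iff T hT]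
      simpa using hx
    have h1 := g.pos p _ h0
    have h2 : T (WithLp.toLp 2 x) = ∑ i, x i • T (EuclideanSpace.single i (1 : ℝ)) := by
      conv_lhs => rw [← (EuclideanSpace.basisFun (Fin n) ℝ).sum_repr (WithLp.toLp 2 x)]
      simp only [map_sum, map_smul]
      simp
    rw [h2] at h1
    simp only [map_sum, map_smul] at h1
    refine lt_of_lt_of_eq h1 ?_
    simp only [dotProduct, Matrix.mulVec, Finset.mul_sum, Matrix.of_apply, star_trivial,
      sum_apply, smul_apply, smul_eq_mul]
    refine Finset.sum_congr rfl fun i _ => Finset.sum_congr rfl fun j _ => ?_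
    rw [g.symm p (T (EuclideanSpace.single i (1 : ℝ)))]
    ring

lemma posDef_gram (g : Metric n M) {a : M} {y : EuclideanSpace ℝ (Fin n)}
    (hy : y ∈ (extChartAt (𝓡∂ n) a).target) : (gram g a y).PosDef := by
  have hs : (extChartAt (𝓡∂ n) a).symm y ∈ (chartAt (EuclideanHalfSpace n) a).source := by
    rw [← extChartAt_source (𝓡∂ n)]; exact (extChartAt (𝓡∂ n) a).map_target hy
  have h := posDef_of_inner g _ _ (symmL_injective hs)
  convert h using 1
  ext i j
  rw [gram_eq g hy, Matrix.of_apply]; rfl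

lemma posDef_fiberGram (g : Metric n M) (p : M) : (fiberGram g p).PosDef :=
  posDef_of_inner g p (ContinuousLinearMap.id ℝ (EuclideanSpace ℝ (Fin n))) Function.injective_id

lemma posDef_bdGram (g : Metric n M) {a : M} {y : EuclideanSpace ℝ (Fin n)}
    (hy : y ∈ (extChartAt (𝓡∂ n) a).target) : (bdGram g a y).PosDef :=
  (posDef_gram g hy).submatrix (Subtype.val_injective)

/-- The matrix formula for the gradient is contracted with the Gram matrix once and for all; later
facts about gradients follow from this duality and the nondegeneracy of the metric. -/
lemma inner_gradient (g : Metric n M) (u : M → ℝ) (p : M) (X : TangentSpace (𝓡∂ n) p) :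
    g.inner p (gradient g u p) X = diff (n := n) u p X := by
  have key : ∀ k, g.inner p (gradient g u p) (EuclideanSpace.single k (1 : ℝ) : EuclideanSpace ℝ (Fin n)) =
      diff (n := n) u p (EuclideanSpace.single k (1 : ℝ) : EuclideanSpace ℝ (Fin n)) := by
    intro k
    have hinv : (fiberGram g p)⁻¹ * fiberGram g p = 1 :=
      Matrix.nonsing_inv_mul _ ((Matrix.isUnit_iff_isUnit_det _).1 (posDef_fiberGram g p).isUnit)
    have hexp : g.inner p (gradient g u p)
        (EuclideanSpace.single k (1 : ℝ) : EuclideanSpace ℝ (Fin n)) =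
        ∑ j, (∑ i, (fiberGram g p)⁻¹ i j *
          diff (n := n) u p (EuclideanSpace.single i (1 : ℝ) : EuclideanSpace ℝ (Fin n))) *
          fiberGram g p j k := by
      have hl : ∀ L : EuclideanSpace ℝ (Fin n) →L[ℝ] EuclideanSpace ℝ (Fin n) →L[ℝ] ℝ,
          ∀ c : Fin n → ℝ, L (∑ j, c j • EuclideanSpace.single j (1 : ℝ))
            (EuclideanSpace.single k (1 : ℝ)) =
          ∑ j, c j * L (EuclideanSpace.single j (1 : ℝ)) (EuclideanSpace.single k (1 : ℝ)) := by
        intro L c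
        simp [map_sum]
      exact hl (g.inner p) _
    rw [hexp]
    simp only [Finset.sum_mul]
    rw [Finset.sum_comm]
    calc _ = ∑ i, diff (n := n) u p (EuclideanSpace.single i (1 : ℝ) : EuclideanSpace ℝ (Fin n)) *
            ((fiberGram g p)⁻¹ * fiberGram g p) i k := by
          simp only [Matrix.mul_apply, Finset.mul_sum]
          exact Finset.sum_congr rfl fun i _ => Finset.sum_congr rfl fun j _ => by ring
      _ = _ := by rw [hinv]; simp [Matrix.one_apply]
  have hlin : ∀ L L' : EuclideanSpace ℝ (Fin n) →L[ℝ] ℝ,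
      (∀ k, L (EuclideanSpace.single k (1 : ℝ)) = L' (EuclideanSpace.single k (1 : ℝ))) →
      ∀ X, L X = L' X := by
    intro L L' h X
    rw [← (EuclideanSpace.basisFun (Fin n) ℝ).sum_repr X]
    simp [map_sum, h]
  exact hlin (g.inner p (gradient g u p)) (mfderiv (𝓡∂ n) 𝓘(ℝ, ℝ) u p) key X

end Frames

/-! ### Densities of volume and boundary area in a chart. -/

section Measures

lemma exists_bound_of_continuousOn {X : Type*} [TopologicalSpace X] {f : X → ℝ} {K T : Set X}
    (hK : IsCompact K) (hKT : K ⊆ T) (hf : ContinuousOn f T) :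
    ∃ C : ℝ, 0 < C ∧ ∀ y ∈ K, |f y| ≤ C := by
  obtain ⟨C, hC⟩ := hK.exists_bound_of_continuousOn (hf.mono hKT)
  exact ⟨max C 1, by positivity, fun y hy => (hC y hy).trans (le_max_left _ _)⟩


lemma continuous_bdPoint {n : ℕ} [NeZero n] : Continuous (bdPoint (n := n)) := by
  unfold bdPoint
  refine (PiLp.continuous_toLp 2 _).comp (continuous_pi fun i => ?_)
  by_cases h : i = 0
  · simp [h, continuous_const]
  · simpa [h] using continuous_apply _

lemma bdPoint_apply {n : ℕ} [NeZero n] (z : {i : Fin n // i ≠ 0} → ℝ) (i : {i : Fin n // i ≠ 0}) :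
    bdPoint z i = z i := by
  simp [bdPoint, i.2]

lemma bdPoint_restrict {n : ℕ} [NeZero n] {y : EuclideanSpace ℝ (Fin n)} (hy : y 0 = 0) :
    bdPoint (fun i => y i) = y := by
  ext i
  by_cases h : i = 0
  · subst h; simp [bdPoint, hy]
  · simp [bdPoint, h]

lemma bdPoint_mem_range {n : ℕ} [NeZero n] (z : {i : Fin n // i ≠ 0} → ℝ) :
    bdPoint z ∈ range (𝓡∂ n) := by
  rw [range_modelWithCornersEuclideanHalfSpace]
  simp [bdPoint]

variable {n : ℕ} [NeZero n] {M : Type*} [TopologicalSpace M]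
  [ChartedSpace (EuclideanHalfSpace n) M]

lemma measurableSet_range_halfSpace : MeasurableSet (range (𝓡∂ n)) :=
  (𝓡∂ n).isClosed_range.measurableSet

lemma measurableSet_extChartAt_target (a : M) :
    MeasurableSet (extChartAt (𝓡∂ n) a).target := by
  rw [extChartAt_target]
  exact (((chartAt _ a).open_target.preimage (𝓡∂ n).continuous_symm).measurableSet).inter
    measurableSet_range_halfSpace

/-- The points of the boundary hyperplane that lie in the chart at `a`. -/
def bdTarget (a : M) : Set ({i : Fin n // i ≠ 0} → ℝ) :=
  {z | bdPoint z ∈ (extChartAt (𝓡∂ n) a).target}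

lemma measurableSet_bdTarget (a : M) : MeasurableSet (bdTarget (n := n) a) :=
  continuous_bdPoint.measurable (measurableSet_extChartAt_target a)

lemma isOpen_bdTarget (a : M) : IsOpen (bdTarget (n := n) a) := by
  have : bdTarget (n := n) a =
      (fun z => (𝓡∂ n).symm (bdPoint z)) ⁻¹' (chartAt (EuclideanHalfSpace n) a).target := by
    ext z
    have hz : bdPoint z ∈ range (𝓡∂ n) := bdPoint_mem_range z
    simp only [bdTarget, extChartAt_target, mem_ofPred_eq, mem_inter_iff, mem_preimage, hz, and_true]
  rw [this]
  exact (chartAt _ a).open_target.preimage ((𝓡∂ n).continuous_symm.comp continuous_bdPoint)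

lemma continuousOn_extChartAt_symm_bdPoint (a : M) :
    ContinuousOn (fun z => (extChartAt (𝓡∂ n) a).symm (bdPoint z)) (bdTarget a) :=
  (continuousOn_extChartAt_symm a).comp continuous_bdPoint.continuousOn fun _ hz => hz

section

variable [MeasurableSpace M] [BorelSpace M]

lemma aemeasurable_extChartAt_symm (a : M) :
    AEMeasurable (extChartAt (𝓡∂ n) a).symm
      ((volume : Measure (EuclideanSpace ℝ (Fin n))).restrict (extChartAt (𝓡∂ n) a).target) :=
  (continuousOn_extChartAt_symm a).aemeasurable (measurableSet_extChartAt_target a)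

lemma aemeasurable_extChartAt_symm_bdPoint (a : M) :
    AEMeasurable (fun z => (extChartAt (𝓡∂ n) a).symm (bdPoint z))
      (volume.restrict (bdTarget a)) :=
  (continuousOn_extChartAt_symm_bdPoint a).aemeasurable (measurableSet_bdTarget a)

end

variable [IsManifold (𝓡∂ n) ∞ M]

/-- The density of the volume in the chart at `a`. -/
def volDensity (g : Metric n M) (a : M) (y : EuclideanSpace ℝ (Fin n)) : ℝ :=
  Real.sqrt (gram g a y).det

/-- The density of the boundary area in the chart at `a`. -/
def areaDensity (g : Metric n M) (a : M) (y : EuclideanSpace ℝ (Fin n)) : ℝ :=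
  Real.sqrt (bdGram g a y).det

lemma continuousOn_volDensity (g : Metric n M) (a : M) :
    ContinuousOn (volDensity g a) (extChartAt (𝓡∂ n) a).target :=
  Real.continuous_sqrt.comp_continuousOn
    ((continuous_id.matrix_det).comp_continuousOn (continuousOn_gram g a))

lemma continuousOn_areaDensity (g : Metric n M) (a : M) :
    ContinuousOn (areaDensity g a) (extChartAt (𝓡∂ n) a).target := by
  refine Real.continuous_sqrt.comp_continuousOn
    ((continuous_id.matrix_det).comp_continuousOn ?_)
  exact (continuous_id.matrix_submatrix _ _).comp_continuousOn (continuousOn_gram g a)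

lemma volDensity_pos (g : Metric n M) {a : M} {y : EuclideanSpace ℝ (Fin n)}
    (hy : y ∈ (extChartAt (𝓡∂ n) a).target) : 0 < volDensity g a y :=
  Real.sqrt_pos.2 (posDef_gram g hy).det_pos

lemma areaDensity_pos (g : Metric n M) {a : M} {y : EuclideanSpace ℝ (Fin n)}
    (hy : y ∈ (extChartAt (𝓡∂ n) a).target) : 0 < areaDensity g a y :=
  Real.sqrt_pos.2 (posDef_bdGram g hy).det_pos

variable [MeasurableSpace M] [BorelSpace M]

lemma lintegral_chartVolume (g : Metric n M) (a : M) {f : M → ENNReal} (hf : Measurable f) :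
    ∫⁻ p, f p ∂(chartVolume g a) = ∫⁻ y in (extChartAt (𝓡∂ n) a).target,
      ENNReal.ofReal (volDensity g a y) * f ((extChartAt (𝓡∂ n) a).symm y) := by
  have hd : AEMeasurable (fun y => ENNReal.ofReal (volDensity g a y))
      (volume.restrict (extChartAt (𝓡∂ n) a).target) :=
    ((continuousOn_volDensity g a).aemeasurable (measurableSet_extChartAt_target a)).ennreal_ofReal
  have hs := aemeasurable_extChartAt_symm (n := n) a
  unfold chartVolume
  rw [lintegral_map' hf.aemeasurable (hs.mono_ac (withDensity_absolutelyContinuous _ _))]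
  exact lintegral_withDensity_eq_lintegral_mul₀ hd (hf.comp_aemeasurable hs)

lemma lintegral_chartArea (g : Metric n M) (a : M) {f : M → ENNReal} (hf : Measurable f) :
    ∫⁻ p, f p ∂(chartArea g a) = ∫⁻ z in bdTarget a,
      ENNReal.ofReal (areaDensity g a (bdPoint z)) *
        f ((extChartAt (𝓡∂ n) a).symm (bdPoint z)) := by
  have hd : AEMeasurable (fun z => ENNReal.ofReal (areaDensity g a (bdPoint z)))
      (volume.restrict (bdTarget a)) :=
    (((continuousOn_areaDensity g a).comp continuous_bdPoint.continuousOn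
      fun _ hz => hz).aemeasurable (measurableSet_bdTarget a)).ennreal_ofReal
  have hs := aemeasurable_extChartAt_symm_bdPoint (n := n) a
  change ∫⁻ p, f p ∂(Measure.map _ ((volume.restrict (bdTarget a)).withDensity _)) = _
  rw [lintegral_map' hf.aemeasurable (hs.mono_ac (withDensity_absolutelyContinuous _ _))]
  exact lintegral_withDensity_eq_lintegral_mul₀ hd (hf.comp_aemeasurable hs)

end Measures

/-! ### The partition of unity: compact supports in the charts, finitely many nonzero functions. -/

section Partition

variable {n : ℕ} [NeZero n] {M : Type*} [TopologicalSpace M]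
  [ChartedSpace (EuclideanHalfSpace n) M] [IsManifold (𝓡∂ n) ∞ M]
  [T2Space M] [CompactSpace M]

lemma tsupport_chartPartition_subset (a : M) :
    tsupport (chartPartition n M a) ⊆ (extChartAt (𝓡∂ n) a).source := by
  rw [extChartAt_source]
  exact (SmoothPartitionOfUnity.exists_isSubordinate_chartAt_source (𝓡∂ n) M).choose_spec a

/-- The image in the chart at `a` of the support of the corresponding function of the partition. -/
def chartSupport (a : M) : Set (EuclideanSpace ℝ (Fin n)) :=
  extChartAt (𝓡∂ n) a '' tsupport (chartPartition n M a)

lemma isCompact_chartSupport (a : M) : IsCompact (chartSupport (n := n) a) :=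
  (isClosed_tsupport _).isCompact.image_of_continuousOn
    ((continuousOn_extChartAt a).mono (tsupport_chartPartition_subset a))

lemma chartSupport_subset (a : M) : chartSupport (n := n) a ⊆ (extChartAt (𝓡∂ n) a).target := by
  rintro _ ⟨p, hp, rfl⟩
  exact (extChartAt (𝓡∂ n) a).map_source (tsupport_chartPartition_subset a hp)

lemma chartPartition_symm_eq_zero {a : M} {y : EuclideanSpace ℝ (Fin n)}
    (hy : y ∈ (extChartAt (𝓡∂ n) a).target) (hK : y ∉ chartSupport a) :
    chartPartition n M a ((extChartAt (𝓡∂ n) a).symm y) = 0 := by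
  by_contra h
  exact hK ⟨_, subset_tsupport _ h, (extChartAt (𝓡∂ n) a).right_inv hy⟩

variable (n M) in
lemma exists_finset_chartPartition :
    ∃ s : Finset M, ∀ a ∉ s, ∀ p, chartPartition n M a p = 0 := by
  have h := (chartPartition n M).locallyFinite.finite_nonempty_of_compact
  refine ⟨h.toFinset, fun a ha p => ?_⟩
  by_contra hp
  exact ha (h.mem_toFinset.2 ⟨p, hp⟩)

end Partition

/-! ### Finiteness of the Riemannian measures and nontriviality of the boundary measure. -/

section RiemannianMeasures

variable {n : ℕ} [NeZero n] {M : Type*} [TopologicalSpace M]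
  [ChartedSpace (EuclideanHalfSpace n) M] [IsManifold (𝓡∂ n) ∞ M]
  [MeasurableSpace M] [BorelSpace M] [T2Space M] [CompactSpace M]

lemma measurable_chartPartition (a : M) :
    Measurable fun p => ENNReal.ofReal (chartPartition n M a p) :=
  (chartPartition n M a).contMDiff.continuous.measurable.ennreal_ofReal

/-- The part of the volume measure carried by the chart at `a`. -/
def volPiece (g : Metric n M) (a : M) : Measure M :=
  (chartVolume g a).withDensity fun p => ENNReal.ofReal (chartPartition n M a p)

/-- The part of the boundary measure carried by the chart at `a`. -/
def areaPiece (g : Metric n M) (a : M) : Measure M :=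
  (chartArea g a).withDensity fun p => ENNReal.ofReal (chartPartition n M a p)

lemma lintegral_volPiece (g : Metric n M) (a : M) {f : M → ENNReal} (hf : Measurable f) :
    ∫⁻ p, f p ∂(volPiece g a) = ∫⁻ y in (extChartAt (𝓡∂ n) a).target,
      ENNReal.ofReal (volDensity g a y) *
        (ENNReal.ofReal (chartPartition n M a ((extChartAt (𝓡∂ n) a).symm y)) *
          f ((extChartAt (𝓡∂ n) a).symm y)) := by
  rw [volPiece, lintegral_withDensity_eq_lintegral_mul _ (measurable_chartPartition a) hf,
    lintegral_chartVolume g a ((measurable_chartPartition a).mul hf)]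
  rfl

lemma lintegral_areaPiece (g : Metric n M) (a : M) {f : M → ENNReal} (hf : Measurable f) :
    ∫⁻ p, f p ∂(areaPiece g a) = ∫⁻ z in bdTarget a,
      ENNReal.ofReal (areaDensity g a (bdPoint z)) *
        (ENNReal.ofReal (chartPartition n M a ((extChartAt (𝓡∂ n) a).symm (bdPoint z))) *
          f ((extChartAt (𝓡∂ n) a).symm (bdPoint z))) := by
  rw [areaPiece, lintegral_withDensity_eq_lintegral_mul _ (measurable_chartPartition a) hf,
    lintegral_chartArea g a ((measurable_chartPartition a).mul hf)]
  rfl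

/-- The partition function confines the integral to a compact subset of the chart target, on which
the continuous density is bounded. -/
lemma exists_lintegral_volPiece_le (g : Metric n M) (a : M) :
    ∃ C : ℝ, ∀ f : M → ENNReal, Measurable f →
      ∫⁻ p, f p ∂(volPiece g a) ≤ ENNReal.ofReal C * ∫⁻ y in (extChartAt (𝓡∂ n) a).target,
        ENNReal.ofReal (chartPartition n M a ((extChartAt (𝓡∂ n) a).symm y)) *
          f ((extChartAt (𝓡∂ n) a).symm y) := by
  obtain ⟨C, -, hC⟩ := exists_bound_of_continuousOn (isCompact_chartSupport (n := n) a)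
    (chartSupport_subset a) (continuousOn_volDensity g a)
  refine ⟨C, fun f hf => ?_⟩
  rw [lintegral_volPiece g a hf, ← lintegral_const_mul' _ _ ENNReal.ofReal_ne_top]
  refine setLIntegral_mono' (measurableSet_extChartAt_target a) fun y hy => ?_
  by_cases hK : y ∈ chartSupport a
  · gcongr
    exact (le_abs_self _).trans (hC y hK)
  · rw [chartPartition_symm_eq_zero hy hK]; simp

lemma exists_lintegral_areaPiece_le (g : Metric n M) (a : M) :
    ∃ C : ℝ, ∀ f : M → ENNReal, Measurable f →
      ∫⁻ p, f p ∂(areaPiece g a) ≤ ENNReal.ofReal C * ∫⁻ z in bdTarget a,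
        ENNReal.ofReal (chartPartition n M a ((extChartAt (𝓡∂ n) a).symm (bdPoint z))) *
          f ((extChartAt (𝓡∂ n) a).symm (bdPoint z)) := by
  obtain ⟨C, -, hC⟩ := exists_bound_of_continuousOn (isCompact_chartSupport (n := n) a)
    (chartSupport_subset a) (continuousOn_areaDensity g a)
  refine ⟨C, fun f hf => ?_⟩
  rw [lintegral_areaPiece g a hf, ← lintegral_const_mul' _ _ ENNReal.ofReal_ne_top]
  refine setLIntegral_mono' (measurableSet_bdTarget a) fun z hz => ?_
  by_cases hK : bdPoint z ∈ chartSupport a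
  · gcongr
    exact (le_abs_self _).trans (hC _ hK)
  · rw [chartPartition_symm_eq_zero hz hK]; simp

/-- The density is also bounded away from 0 on the compact support. This direction carries a
Euclidean estimate back to the manifold, and it requires the integrand to contain a factor of the
partition function. -/
lemma exists_le_lintegral_volPiece (g : Metric n M) (a : M) :
    ∃ C : ℝ, ∀ f : M → ENNReal, Measurable f →
      ∫⁻ y in (extChartAt (𝓡∂ n) a).target,
        ENNReal.ofReal (chartPartition n M a ((extChartAt (𝓡∂ n) a).symm y)) *
          f ((extChartAt (𝓡∂ n) a).symm y) ≤ ENNReal.ofReal C * ∫⁻ p, f p ∂(volPiece g a) := by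
  obtain ⟨C, hC0, hC⟩ := exists_bound_of_continuousOn (isCompact_chartSupport (n := n) a)
    (chartSupport_subset a)
    ((continuousOn_volDensity g a).inv₀ fun y hy => (volDensity_pos g hy).ne')
  refine ⟨C, fun f hf => ?_⟩
  rw [lintegral_volPiece g a hf, ← lintegral_const_mul' _ _ ENNReal.ofReal_ne_top]
  refine setLIntegral_mono' (measurableSet_extChartAt_target a) fun y hy => ?_
  by_cases hK : y ∈ chartSupport a
  · rw [← mul_assoc, ← ENNReal.ofReal_mul hC0.le]
    refine le_mul_of_one_le_left' ?_
    rw [ENNReal.one_le_ofReal]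
    have h1 := (le_abs_self _).trans (hC y hK)
    rwa [Pi.inv_apply, inv_le_iff_one_le_mul₀ (volDensity_pos g hy)] at h1
  · rw [chartPartition_symm_eq_zero hy hK]; simp

lemma isFiniteMeasure_volPiece (g : Metric n M) (a : M) : IsFiniteMeasure (volPiece g a) := by
  refine ⟨?_⟩
  obtain ⟨C, hC⟩ := exists_lintegral_volPiece_le g a
  have h1 := hC 1 measurable_one
  simp only [Pi.one_apply, lintegral_one, mul_one] at h1
  refine h1.trans_lt (ENNReal.mul_lt_top ENNReal.ofReal_lt_top ?_)
  calc _ ≤ ∫⁻ y in (extChartAt (𝓡∂ n) a).target, (chartSupport (n := n) a).indicator 1 y := by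
        refine setLIntegral_mono' (measurableSet_extChartAt_target a) fun y hy => ?_
        by_cases hK : y ∈ chartSupport a
        · simpa [hK] using (chartPartition n M).le_one a _
        · rw [chartPartition_symm_eq_zero hy hK]; simp
    _ ≤ ∫⁻ y, (chartSupport (n := n) a).indicator 1 y := setLIntegral_le_lintegral _ _
    _ = volume (chartSupport (n := n) a) :=
        lintegral_indicator_one (isCompact_chartSupport a).measurableSet
    _ < ⊤ := (isCompact_chartSupport a).measure_lt_top

lemma isFiniteMeasure_areaPiece (g : Metric n M) (a : M) : IsFiniteMeasure (areaPiece g a) := by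
  refine ⟨?_⟩
  obtain ⟨C, hC⟩ := exists_lintegral_areaPiece_le g a
  have h1 := hC 1 measurable_one
  simp only [Pi.one_apply, lintegral_one, mul_one] at h1
  refine h1.trans_lt (ENNReal.mul_lt_top ENNReal.ofReal_lt_top ?_)
  -- The projection of the support to the boundary coordinates is compact, hence of finite measure,
  -- and contains every `z` with `bdPoint z` in the support.
  set K : Set ({i : Fin n // i ≠ 0} → ℝ) := (fun y i => y i) '' chartSupport (n := n) a with hKdef
  have hKc : IsCompact K := (isCompact_chartSupport a).image (by fun_prop)
  calc _ ≤ ∫⁻ z in bdTarget (n := n) a, K.indicator 1 z := by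
        refine setLIntegral_mono' (measurableSet_bdTarget a) fun z hz => ?_
        by_cases hK : bdPoint z ∈ chartSupport a
        · have : z ∈ K := ⟨_, hK, funext (bdPoint_apply z)⟩
          simpa [this] using (chartPartition n M).le_one a _
        · rw [chartPartition_symm_eq_zero hz hK]; simp
    _ ≤ ∫⁻ z, K.indicator 1 z := setLIntegral_le_lintegral _ _
    _ = volume K := lintegral_indicator_one hKc.measurableSet
    _ < ⊤ := hKc.measure_lt_top

lemma isFiniteMeasure_sum_of_finset {ι Ω : Type*} [MeasurableSpace Ω] {μ : ι → Measure Ω}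
    (s : Finset ι) (hs : ∀ i ∉ s, μ i = 0) (h : ∀ i, IsFiniteMeasure (μ i)) :
    IsFiniteMeasure (Measure.sum μ) := by
  refine ⟨?_⟩
  rw [Measure.sum_apply _ MeasurableSet.univ, tsum_eq_sum (s := s) fun i hi => by simp [hs i hi]]
  exact ENNReal.sum_lt_top.2 fun i _ => measure_lt_top _ _

/-- The Riemannian measures are sums over all points of M, and the property in question is not
assumed to be measurable; a finite set of nonzero summands reduces the claim to a finite sum. -/
lemma ae_sum_of_finset {ι Ω : Type*} [MeasurableSpace Ω] {μ : ι → Measure Ω}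
    (s : Finset ι) (hs : ∀ i ∉ s, μ i = 0) {P : Ω → Prop} (h : ∀ i, ∀ᵐ x ∂(μ i), P x) :
    ∀ᵐ x ∂(Measure.sum μ), P x := by
  have heq : Measure.sum μ = ∑ i ∈ s, μ i := by
    ext t ht
    rw [Measure.sum_apply _ ht, tsum_eq_sum (s := s) fun i hi => by simp [hs i hi]]
    simp
  rw [heq, ae_iff, Measure.finsetSum_apply]
  exact Finset.sum_eq_zero fun i _ => ae_iff.1 (h i)

variable (n M) in
lemma exists_finset_volPiece_areaPiece (g : Metric n M) :
    ∃ s : Finset M, ∀ a ∉ s, volPiece g a = 0 ∧ areaPiece g a = 0 := by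
  obtain ⟨s, hs⟩ := exists_finset_chartPartition n M
  refine ⟨s, fun a ha => ?_⟩
  simp only [volPiece, areaPiece, hs a ha, ENNReal.ofReal_zero]
  exact ⟨withDensity_zero, withDensity_zero⟩

instance isFiniteMeasure_riemVolume (g : Metric n M) : IsFiniteMeasure (riemVolume g) := by
  obtain ⟨s, hs⟩ := exists_finset_volPiece_areaPiece n M g
  exact isFiniteMeasure_sum_of_finset s (fun a ha => (hs a ha).1) (isFiniteMeasure_volPiece g)

instance isFiniteMeasure_riemArea (g : Metric n M) : IsFiniteMeasure (riemArea g) := by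
  obtain ⟨s, hs⟩ := exists_finset_volPiece_areaPiece n M g
  exact isFiniteMeasure_sum_of_finset s (fun a ha => (hs a ha).2) (isFiniteMeasure_areaPiece g)

lemma volPiece_le (g : Metric n M) (a : M) : volPiece g a ≤ riemVolume g :=
  Measure.le_sum (fun a => volPiece g a) a

lemma areaPiece_le (g : Metric n M) (a : M) : areaPiece g a ≤ riemArea g :=
  Measure.le_sum (fun a => areaPiece g a) a

/-- Being a boundary point can be tested in any chart of the atlas; a positive zeroth coordinate
would place the image in the interior of the half-space. -/
lemma extChartAt_apply_zero_of_mem_boundary {a p : M} (hp : p ∈ (𝓡∂ n).boundary M)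
    (ha : p ∈ (chartAt (EuclideanHalfSpace n) a).source) : extChartAt (𝓡∂ n) a p 0 = 0 := by
  have h := ((𝓡∂ n).isBoundaryPoint_iff_of_mem_atlas (n := ∞) (by simp)
    (chart_mem_atlas (EuclideanHalfSpace n) a) ha).1 hp
  by_contra h0
  have hr : extChartAt (𝓡∂ n) a p ∈ range (𝓡∂ n) := mem_range_self _
  rw [range_modelWithCornersEuclideanHalfSpace] at hr
  have hi : extChartAt (𝓡∂ n) a p ∈ interior (range (𝓡∂ n)) := by
    rw [interior_range_modelWithCornersEuclideanHalfSpace]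
    exact lt_of_le_of_ne hr (Ne.symm h0)
  exact h.2 ((chartAt (EuclideanHalfSpace n) a).mem_interior_extend_target
    ((chartAt (EuclideanHalfSpace n) a).map_source ha) hi)

/-- Some partition function is positive at a given boundary point, hence on a nonempty open set of
boundary coordinates. The area density is positive there as well, and open sets have positive
Lebesgue measure. -/
lemma riemArea_ne_zero (g : Metric n M) (hbd : ((𝓡∂ n).boundary M).Nonempty) :
    riemArea g ≠ 0 := by
  obtain ⟨p, hp⟩ := hbd
  obtain ⟨a, ha⟩ := (chartPartition n M).exists_pos_of_mem (mem_univ p)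
  intro h0
  have hpa : areaPiece g a = 0 := le_antisymm ((areaPiece_le g a).trans h0.le) (Measure.zero_le _)
  have hps : p ∈ (extChartAt (𝓡∂ n) a).source :=
    tsupport_chartPartition_subset a (subset_tsupport _ ha.ne')
  have hp0 := extChartAt_apply_zero_of_mem_boundary hp (by rwa [← extChartAt_source (𝓡∂ n)])
  set z₀ : {i : Fin n // i ≠ 0} → ℝ := fun i => extChartAt (𝓡∂ n) a p i
  have hz₀ : bdPoint z₀ = extChartAt (𝓡∂ n) a p := bdPoint_restrict hp0
  set φ : ({i : Fin n // i ≠ 0} → ℝ) → M := fun z => (extChartAt (𝓡∂ n) a).symm (bdPoint z)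
  have hφ : ContinuousOn φ (bdTarget a) := continuousOn_extChartAt_symm_bdPoint a
  set W : Set ({i : Fin n // i ≠ 0} → ℝ) := bdTarget a ∩ φ ⁻¹' {q | 0 < chartPartition n M a q}
  have hW : IsOpen W := hφ.isOpen_inter_preimage (isOpen_bdTarget a)
    (isOpen_lt continuous_const (chartPartition n M a).contMDiff.continuous)
  have hzW : z₀ ∈ W := by
    have hT : bdPoint z₀ ∈ (extChartAt (𝓡∂ n) a).target := by
      rw [hz₀]; exact (extChartAt (𝓡∂ n) a).map_source hps
    refine ⟨hT, ?_⟩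
    simp only [φ, mem_preimage, hz₀, (extChartAt (𝓡∂ n) a).left_inv hps]
    exact ha
  have hWpos : volume W ≠ 0 := (hW.measure_pos volume ⟨z₀, hzW⟩).ne'
  have hint := lintegral_areaPiece g a (f := 1) measurable_one
  rw [hpa, lintegral_zero_measure] at hint
  have hmeas : AEMeasurable (fun z => ENNReal.ofReal (areaDensity g a (bdPoint z)) *
      (ENNReal.ofReal (chartPartition n M a (φ z)) * 1)) (volume.restrict (bdTarget a)) := by
    have hd : AEMeasurable (fun z => ENNReal.ofReal (areaDensity g a (bdPoint z)))
        (volume.restrict (bdTarget a)) :=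
      (((continuousOn_areaDensity g a).comp continuous_bdPoint.continuousOn
        fun _ hz => hz).aemeasurable (measurableSet_bdTarget a)).ennreal_ofReal
    exact hd.mul (((measurable_chartPartition a).comp_aemeasurable
      (aemeasurable_extChartAt_symm_bdPoint a)).mul aemeasurable_const)
  have hae := (lintegral_eq_zero_iff' hmeas).1 hint.symm
  have hae' := ae_iff.1 ((ae_restrict_iff' (measurableSet_bdTarget a)).1 hae)
  refine hWpos (measure_mono_null (fun z hz => ?_) hae')
  have h1 := areaDensity_pos g (a := a) hz.1
  have h2 : 0 < chartPartition n M a (φ z) := hz.2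
  simpa [h1, h2] using hz.1

end RiemannianMeasures

/-! ### The weighted measures are comparable to the Riemannian ones. -/

namespace SmoothMMS

variable {n : ℕ} [NeZero n] {M : Type*} [TopologicalSpace M]
  [ChartedSpace (EuclideanHalfSpace n) M] [IsManifold (𝓡∂ n) ∞ M]
  [MeasurableSpace M] [BorelSpace M] [T2Space M] [CompactSpace M]

lemma continuous_φ (X : SmoothMMS n M) : Continuous X.φ := X.φ_smooth.continuous

lemma exists_abs_φ_le (X : SmoothMMS n M) : ∃ C : ℝ, ∀ p, |X.φ p| ≤ C := by
  obtain ⟨C, -, hC⟩ := exists_bound_of_continuousOn isCompact_univ subset_rfl X.continuous_φ.continuousOn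
  exact ⟨C, fun p => hC p (mem_univ p)⟩

/-- By compactness `φ` is bounded, so the weight lies between two positive constants. The constant
is independent of the measure and serves both the interior and the boundary. -/
lemma exists_withDensity_le (X : SmoothMMS n M) : ∃ C : ℝ, ∀ μ : Measure M,
    μ.withDensity (fun p => ENNReal.ofReal (Real.exp (-(X.φ p)))) ≤ ENNReal.ofReal C • μ ∧
    μ ≤ ENNReal.ofReal C • μ.withDensity (fun p => ENNReal.ofReal (Real.exp (-(X.φ p)))) := by
  obtain ⟨C, hC⟩ := X.exists_abs_φ_le
  refine ⟨Real.exp C, fun μ => ⟨?_, ?_⟩⟩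
  · rw [← withDensity_const]
    refine withDensity_mono (.of_forall fun p => ?_)
    refine ENNReal.ofReal_le_ofReal (Real.exp_le_exp.2 ?_)
    linarith [neg_abs_le (X.φ p), hC p]
  · have hm : Measurable fun p => ENNReal.ofReal (Real.exp (-(X.φ p))) :=
      (Real.continuous_exp.comp X.continuous_φ.neg).measurable.ennreal_ofReal
    rw [← withDensity_smul _ hm]
    conv_lhs => rw [← withDensity_one (μ := μ)]
    refine withDensity_mono (.of_forall fun p => ?_)
    simp only [Pi.one_apply, Pi.smul_apply, smul_eq_mul]
    rw [← ENNReal.ofReal_mul (Real.exp_pos _).le, ENNReal.one_le_ofReal, ← Real.exp_add,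
      Real.one_le_exp_iff]
    linarith [le_abs_self (X.φ p), hC p]

instance (X : SmoothMMS n M) : IsFiniteMeasure X.vol := by
  obtain ⟨C, hC⟩ := X.exists_withDensity_le
  refine ⟨((hC (riemVolume X.g)).1 univ).trans_lt ?_⟩
  simpa using ENNReal.mul_lt_top ENNReal.ofReal_lt_top (measure_lt_top (riemVolume X.g) univ)

instance (X : SmoothMMS n M) : IsFiniteMeasure X.area := by
  obtain ⟨C, hC⟩ := X.exists_withDensity_le
  refine ⟨((hC (riemArea X.g)).1 univ).trans_lt ?_⟩
  simpa using ENNReal.mul_lt_top ENNReal.ofReal_lt_top (measure_lt_top (riemArea X.g) univ)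

lemma area_ne_zero (X : SmoothMMS n M) (hbd : ((𝓡∂ n).boundary M).Nonempty) : X.area ≠ 0 := by
  obtain ⟨C, hC⟩ := X.exists_withDensity_le
  intro h
  have h1 := (hC (riemArea X.g)).2
  change _ ≤ ENNReal.ofReal C • X.area at h1
  rw [h, smul_zero] at h1
  exact riemArea_ne_zero X.g hbd (le_antisymm h1 (Measure.zero_le _))

end SmoothMMS

/-! ### The trace inequality on the half-space. -/

section HalfSpaceTrace

variable {n : ℕ} [NeZero n]

/-- The point with zeroth coordinate `t` and the given other coordinates. -/
def slicePoint (z : {i : Fin n // i ≠ 0} → ℝ) (t : ℝ) : EuclideanSpace ℝ (Fin n) :=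
  WithLp.toLp 2 fun i => if h : i = 0 then t else z ⟨i, h⟩

lemma slicePoint_zero (z : {i : Fin n // i ≠ 0} → ℝ) : slicePoint z 0 = bdPoint z := rfl

lemma slicePoint_apply_zero (z : {i : Fin n // i ≠ 0} → ℝ) (t : ℝ) : slicePoint z t 0 = t := by
  simp [slicePoint]

lemma slicePoint_eq (z : {i : Fin n // i ≠ 0} → ℝ) (t : ℝ) :
    slicePoint z t = bdPoint z + t • EuclideanSpace.single 0 (1 : ℝ) := by
  ext i
  by_cases h : i = 0
  · subst h; simp [slicePoint, bdPoint]
  · simp [slicePoint, bdPoint, h]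

lemma hasDerivAt_slicePoint (z : {i : Fin n // i ≠ 0} → ℝ) (t : ℝ) :
    HasDerivAt (slicePoint z) (EuclideanSpace.single 0 (1 : ℝ)) t := by
  have : slicePoint z = fun t => bdPoint z + t • EuclideanSpace.single 0 (1 : ℝ) :=
    funext (slicePoint_eq z)
  rw [this]
  simpa using ((hasDerivAt_id t).smul_const (EuclideanSpace.single (0 : Fin n) (1 : ℝ))).const_add
    (bdPoint z)

lemma slicePoint_mem_range {z : {i : Fin n // i ≠ 0} → ℝ} {t : ℝ} :
    slicePoint z t ∈ range (𝓡∂ n) ↔ 0 ≤ t := by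
  rw [range_modelWithCornersEuclideanHalfSpace]
  simp [slicePoint_apply_zero]

/-- Splits off the normal coordinate, so that integrals over the half-space become iterated
integrals along normal lines. -/
lemma measurePreserving_slicePoint :
    MeasurePreserving (fun x : ({i : Fin n // i ≠ 0} → ℝ) × ℝ => slicePoint x.1 x.2) := by
  have : Unique {i : Fin n // ¬ (i ≠ 0)} := ⟨⟨⟨0, by simp⟩⟩, fun i => Subtype.ext (by simpa using i.2)⟩
  have h1 := (volume_preserving_piEquivPiSubtypeProd (fun _ : Fin n => ℝ) (fun i => i ≠ 0)).symm
  have h2 : MeasurePreserving (MeasurableEquiv.funUnique {i : Fin n // ¬ (i ≠ 0)} ℝ).symm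
      volume volume := by
    convert (volume_preserving_funUnique {i : Fin n // ¬ (i ≠ 0)} ℝ).symm
  have h3 := (MeasurePreserving.id (volume : Measure ({i : Fin n // i ≠ 0} → ℝ))).prod h2
  have h4 := PiLp.volume_preserving_toLp (Fin n)
  have h5 : MeasurePreserving (fun x => (MeasurableEquiv.piEquivPiSubtypeProd
      (fun _ : Fin n => ℝ) (fun i => i ≠ 0)).symm
      (Prod.map id (MeasurableEquiv.funUnique {i : Fin n // ¬ (i ≠ 0)} ℝ).symm x))
      (volume.prod volume) volume := MeasurePreserving.comp (μb := volume.prod volume) h1 h3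
  have := h4.comp h5
  rw [← Measure.volume_eq_prod] at this
  convert this using 1
  ext x i
  by_cases h : i = 0
  · simp [slicePoint, h, Equiv.piEquivPiSubtypeProd, MeasurableEquiv.piEquivPiSubtypeProd]
  · simp [slicePoint, h, Equiv.piEquivPiSubtypeProd, MeasurableEquiv.piEquivPiSubtypeProd]

lemma lintegral_range_halfSpace {G : EuclideanSpace ℝ (Fin n) → ENNReal}
    (hG : AEMeasurable G (volume.restrict (range (𝓡∂ n)))) :
    ∫⁻ y in range (𝓡∂ n), G y =
      ∫⁻ z : {i : Fin n // i ≠ 0} → ℝ, ∫⁻ t in Ici (0 : ℝ), G (slicePoint z t) := by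
  have hG' : AEMeasurable ((range (𝓡∂ n)).indicator G) volume :=
    (aemeasurable_indicator_iff measurableSet_range_halfSpace).2 hG
  have hmp := measurePreserving_slicePoint (n := n)
  rw [← lintegral_indicator measurableSet_range_halfSpace,
    ← hmp.map_eq, lintegral_map' (by rwa [hmp.map_eq]) hmp.measurable.aemeasurable,
    Measure.volume_eq_prod, lintegral_prod]
  · refine lintegral_congr fun z => ?_
    rw [← lintegral_indicator measurableSet_Ici]
    refine lintegral_congr fun t => ?_
    by_cases ht : 0 ≤ t
    · rw [indicator_of_mem (slicePoint_mem_range.2 ht), indicator_of_mem (mem_Ici.2 ht)]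
    · rw [indicator_of_notMem (fun h => ht (slicePoint_mem_range.1 h)),
        indicator_of_notMem (fun h => ht (mem_Ici.1 h))]
  · exact hG'.comp_quasiMeasurePreserving hmp.quasiMeasurePreserving

/-- The trace inequality on the half-space for functions with compact support. -/
lemma lintegral_bdPoint_le {F : EuclideanSpace ℝ (Fin n) → ℝ} {K : Set (EuclideanSpace ℝ (Fin n))}
    (hK : IsCompact K) (hF0 : ∀ y ∈ range (𝓡∂ n), y ∉ K → F y = 0)
    (hF : ContDiffOn ℝ 1 F (range (𝓡∂ n))) :
    ∫⁻ z, ‖F (bdPoint z)‖ₑ ≤ ∫⁻ y in range (𝓡∂ n), ‖pd 0 F y‖ₑ := by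
  have hcont : ContinuousOn (pd 0 F) (range (𝓡∂ n)) :=
    (hF.continuousOn_fderivWithin (𝓡∂ n).uniqueDiffOn le_rfl).clm_apply continuousOn_const
  rw [lintegral_range_halfSpace (hcont.aemeasurable measurableSet_range_halfSpace).enorm]
  obtain ⟨R, hR0, hR⟩ := exists_bound_of_continuousOn (f := fun y : EuclideanSpace ℝ (Fin n) => y 0)
    hK (subset_univ K) (by fun_prop)
  refine lintegral_mono fun z => ?_
  have hsl : Continuous (slicePoint z) :=
    continuous_iff_continuousAt.2 fun t => (hasDerivAt_slicePoint z t).continuousAt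
  have hmaps : MapsTo (slicePoint z) (Ici 0) (range (𝓡∂ n)) := fun t ht => slicePoint_mem_range.2 ht
  have hf' : ContinuousOn (fun t => pd 0 F (slicePoint z t)) (Ici 0) :=
    hcont.comp hsl.continuousOn hmaps
  have hf : ContinuousOn (fun t => F (slicePoint z t)) (Ici 0) :=
    hF.continuousOn.comp hsl.continuousOn hmaps
  -- `R` bounds the zeroth coordinate on the support, so at height `R + 1` every normal line has
  -- left it.
  have hT : (0 : ℝ) ≤ R + 1 := by linarith
  have hend : F (slicePoint z (R + 1)) = 0 := by
    refine hF0 _ (slicePoint_mem_range.2 hT) fun h => ?_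
    have := hR _ h
    rw [slicePoint_apply_zero] at this
    linarith [le_abs_self (R + 1)]
  -- At positive height the half-space is a neighbourhood of the point, so the derivative within it
  -- is a genuine derivative; at height 0 continuity suffices.
  have hftc := intervalIntegral.integral_eq_sub_of_hasDerivAt_of_le hT
    (hf.mono Icc_subset_Ici_self) (f' := fun t => pd 0 F (slicePoint z t))
    (fun t ht => by
      have hmem : range (𝓡∂ n) ∈ 𝓝 (slicePoint z t) := by
        rw [← mem_interior_iff_mem_nhds, interior_range_modelWithCornersEuclideanHalfSpace]
        simpa [slicePoint_apply_zero] using ht.1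
      have hd : HasFDerivAt F (fderivWithin ℝ F (range (𝓡∂ n)) (slicePoint z t)) (slicePoint z t) :=
        (((hF.differentiableOn one_ne_zero) _ (mem_of_mem_nhds hmem)).hasFDerivWithinAt).hasFDerivAt hmem
      exact hd.comp_hasDerivAt t (hasDerivAt_slicePoint z t))
    ((hf'.mono (by rw [uIcc_of_le hT]; exact Icc_subset_Ici_self)).intervalIntegrable)
  rw [hend, slicePoint_zero, zero_sub] at hftc
  rw [← enorm_neg, ← hftc, intervalIntegral.integral_of_le hT]
  refine (enorm_integral_le_lintegral_enorm _).trans (lintegral_mono_set ?_)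
  exact fun t ht => ht.1.le

end HalfSpaceTrace

/-! ### The trace inequality in a chart, localized by the partition of unity. -/

section ChartTrace

variable {n : ℕ} [NeZero n] {M : Type*} [TopologicalSpace M]
  [ChartedSpace (EuclideanHalfSpace n) M] [IsManifold (𝓡∂ n) ∞ M]

lemma contDiffOn_comp_extChartAt_symm {u : M → ℝ} (hu : IsSmooth n u) (a : M) :
    ContDiffOn ℝ ∞ (u ∘ (extChartAt (𝓡∂ n) a).symm) (extChartAt (𝓡∂ n) a).target :=
  contMDiffOn_iff_contDiffOn.1 (hu.comp_contMDiffOn (contMDiffOn_extChartAt_symm a))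

lemma contDiffWithinAt_comp_extChartAt_symm {u : M → ℝ} (hu : IsSmooth n u) (a : M)
    {y : EuclideanSpace ℝ (Fin n)} (hy : y ∈ (extChartAt (𝓡∂ n) a).target) :
    ContDiffWithinAt ℝ ∞ (u ∘ (extChartAt (𝓡∂ n) a).symm) (range (𝓡∂ n)) y :=
  (contDiffOn_comp_extChartAt_symm hu a y hy).mono_of_mem_nhdsWithin
    (extChartAt_target_mem_nhdsWithin_of_mem hy)

lemma diff_coordVec {u : M → ℝ} (hu : IsSmooth n u) (a : M)
    {y : EuclideanSpace ℝ (Fin n)} (hy : y ∈ (extChartAt (𝓡∂ n) a).target) (i : Fin n) :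
    diff (n := n) u ((extChartAt (𝓡∂ n) a).symm y)
      (chartFrame a ((extChartAt (𝓡∂ n) a).symm y) i) =
      pd i (u ∘ (extChartAt (𝓡∂ n) a).symm) y := by
  have : IsManifold (𝓡∂ n) 1 M := IsManifold.of_le (n := ∞) (by norm_cast)
  have hyr : y ∈ range (𝓡∂ n) := extChartAt_target_subset_range a hy
  rw [← coordVec_eq_chartFrame hy, pd, ← mfderivWithin_eq_fderivWithin,
    mfderiv_comp_mfderivWithin (I' := 𝓡∂ n) y (hu.mdifferentiable (by simp) _)
      (mdifferentiableWithinAt_extChartAt_symm hy)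
      ((𝓡∂ n).uniqueMDiffOn y hyr)]
  rfl

lemma continuousOn_pd_comp_extChartAt_symm {u : M → ℝ} (hu : IsSmooth n u) (a : M) (i : Fin n) :
    ContinuousOn (pd i (u ∘ (extChartAt (𝓡∂ n) a).symm)) (extChartAt (𝓡∂ n) a).target := by
  have h := ((contDiffOn_comp_extChartAt_symm hu a).continuousOn_fderivWithin
    (uniqueDiffOn_extChartAt_target a) (by simp)).clm_apply
    (continuousOn_const (c := EuclideanSpace.single i (1 : ℝ)))
  refine h.congr fun y hy => ?_
  rw [pd, fderivWithin_of_mem_nhdsWithin (extChartAt_target_mem_nhdsWithin_of_mem hy)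
    ((𝓡∂ n).uniqueDiffOn y (extChartAt_target_subset_range a hy))
    ((contDiffOn_comp_extChartAt_symm hu a y hy).differentiableWithinAt (by simp))]

lemma continuousOn_diff_chartFrame {u : M → ℝ} (hu : IsSmooth n u) (a : M) (i : Fin n) :
    ContinuousOn (fun p => diff (n := n) u p (chartFrame a p i))
      (extChartAt (𝓡∂ n) a).source := by
  refine ((continuousOn_pd_comp_extChartAt_symm hu a i).comp (continuousOn_extChartAt a)
    (fun p hp => (extChartAt (𝓡∂ n) a).map_source hp)).congr fun p hp => ?_
  have := diff_coordVec hu a ((extChartAt (𝓡∂ n) a).map_source hp) i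
  rw [(extChartAt (𝓡∂ n) a).left_inv hp] at this
  exact this

lemma pd_mul {i : Fin n} {f h : EuclideanSpace ℝ (Fin n) → ℝ} {y : EuclideanSpace ℝ (Fin n)}
    (hy : y ∈ range (𝓡∂ n)) (hf : DifferentiableWithinAt ℝ f (range (𝓡∂ n)) y)
    (hh : DifferentiableWithinAt ℝ h (range (𝓡∂ n)) y) :
    pd i (fun y => f y * h y) y = f y * pd i h y + h y * pd i f y := by
  unfold pd
  rw [fderivWithin_fun_mul ((𝓡∂ n).uniqueDiffOn y hy) hf hh]
  simp

variable [T2Space M] [CompactSpace M]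

lemma isSmooth_chartPartition (a : M) : IsSmooth n (chartPartition n M a) :=
  (chartPartition n M a).contMDiff

/-- The derivative in the direction of the zeroth coordinate of the chart at `a`, localized by the
partition of unity. -/
def localizedDeriv (a : M) (u : M → ℝ) (p : M) : ℝ :=
  chartPartition n M a p * diff (n := n) u p (chartFrame a p 0)

lemma chartPartition_eq_zero {a p : M} (hp : p ∉ (extChartAt (𝓡∂ n) a).source) :
    chartPartition n M a p = 0 :=
  image_eq_zero_of_notMem_tsupport fun h => hp (tsupport_chartPartition_subset a h)

lemma exists_bound_localizedDeriv {u : M → ℝ} (hu : IsSmooth n u) (a : M) :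
    ∃ C : ℝ, ∀ p, |localizedDeriv (n := n) a u p| ≤ C := by
  obtain ⟨C, hC0, hC⟩ := exists_bound_of_continuousOn
    (isClosed_tsupport (chartPartition n M a)).isCompact
    (tsupport_chartPartition_subset a) (continuousOn_diff_chartFrame hu a 0)
  refine ⟨C, fun p => ?_⟩
  by_cases hp : p ∈ tsupport (chartPartition n M a)
  · rw [localizedDeriv, abs_mul, abs_of_nonneg ((chartPartition n M).nonneg a p)]
    exact (mul_le_of_le_one_left (abs_nonneg _) ((chartPartition n M).le_one a p)).trans (hC p hp)
  · simp [localizedDeriv, image_eq_zero_of_notMem_tsupport hp, hC0.le]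

variable [MeasurableSpace M] [BorelSpace M]

lemma measurable_localizedDeriv {u : M → ℝ} (hu : IsSmooth n u) (a : M) :
    Measurable (localizedDeriv (n := n) a u) := by
  classical
  have hm : Measurable ((extChartAt (𝓡∂ n) a).source.piecewise (localizedDeriv (n := n) a u) 0) :=
    ContinuousOn.measurable_piecewise
      ((chartPartition n M a).contMDiff.continuous.continuousOn.mul
        (continuousOn_diff_chartFrame hu a 0)) continuousOn_const
      (isOpen_extChartAt_source a).measurableSet
  convert hm using 1
  ext p
  by_cases hp : p ∈ (extChartAt (𝓡∂ n) a).source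
  · rw [piecewise_eq_of_mem _ _ _ hp]
  · rw [piecewise_eq_of_notMem _ _ _ hp, localizedDeriv, chartPartition_eq_zero hp, zero_mul]; rfl

lemma memLp_localizedDeriv {u : M → ℝ} (hu : IsSmooth n u) (a : M) (μ : Measure M)
    [IsFiniteMeasure μ] : MemLp (localizedDeriv (n := n) a u) 2 μ := by
  obtain ⟨C, hC⟩ := exists_bound_localizedDeriv hu a
  exact MemLp.of_bound (measurable_localizedDeriv hu a).aestronglyMeasurable C
    (.of_forall fun p => hC p)

/-- The function whose boundary integral is estimated in the trace inequality, in the chart. -/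
def chartSquare (a : M) (u : M → ℝ) : EuclideanSpace ℝ (Fin n) → ℝ :=
  (extChartAt (𝓡∂ n) a).target.indicator fun y =>
    ((chartPartition n M a ∘ (extChartAt (𝓡∂ n) a).symm) y *
      (u ∘ (extChartAt (𝓡∂ n) a).symm) y) *
    ((chartPartition n M a ∘ (extChartAt (𝓡∂ n) a).symm) y *
      (u ∘ (extChartAt (𝓡∂ n) a).symm) y)

lemma chartSquare_eq_zero {a : M} (u : M → ℝ) {y : EuclideanSpace ℝ (Fin n)}
    (hK : y ∉ chartSupport (n := n) a) : chartSquare a u y = 0 := by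
  by_cases hy : y ∈ (extChartAt (𝓡∂ n) a).target
  · rw [chartSquare, indicator_of_mem hy, Function.comp_apply, chartPartition_symm_eq_zero hy hK]
    simp
  · rw [chartSquare, indicator_of_notMem hy]

lemma chartSquare_eventuallyEq_zero {a : M} (u : M → ℝ) {y : EuclideanSpace ℝ (Fin n)}
    (hK : y ∉ chartSupport (n := n) a) :
    chartSquare a u =ᶠ[𝓝[range (𝓡∂ n)] y] fun _ => 0 :=
  Filter.Eventually.filter_mono nhdsWithin_le_nhds
    (Filter.eventually_of_mem ((isCompact_chartSupport a).isClosed.isOpen_compl.mem_nhds hK)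
      fun _ hz => chartSquare_eq_zero u hz)

lemma chartSquare_eventuallyEq {a : M} (u : M → ℝ) {y : EuclideanSpace ℝ (Fin n)}
    (hy : y ∈ (extChartAt (𝓡∂ n) a).target) :
    chartSquare a u =ᶠ[𝓝[range (𝓡∂ n)] y] fun y =>
    ((chartPartition n M a ∘ (extChartAt (𝓡∂ n) a).symm) y *
      (u ∘ (extChartAt (𝓡∂ n) a).symm) y) *
    ((chartPartition n M a ∘ (extChartAt (𝓡∂ n) a).symm) y *
      (u ∘ (extChartAt (𝓡∂ n) a).symm) y) := by
  filter_upwards [extChartAt_target_mem_nhdsWithin_of_mem hy] with z hz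
  rw [chartSquare, indicator_of_mem hz]

/-- The extension by zero is regular because the support is closed and lies inside the chart target:
outside the target the function vanishes in a neighbourhood. -/
lemma contDiffOn_chartSquare (a : M) {u : M → ℝ} (hu : IsSmooth n u) :
    ContDiffOn ℝ 1 (chartSquare (n := n) a u) (range (𝓡∂ n)) := by
  intro y hyr
  by_cases hy : y ∈ (extChartAt (𝓡∂ n) a).target
  · have h1 := contDiffWithinAt_comp_extChartAt_symm (isSmooth_chartPartition a) a hy
    have h2 := contDiffWithinAt_comp_extChartAt_symm hu a hy
    exact (((h1.mul h2).mul (h1.mul h2)).of_le (by norm_cast)).congr_of_eventuallyEq_of_mem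
      (chartSquare_eventuallyEq u hy) hyr
  · exact contDiffWithinAt_const.congr_of_eventuallyEq_of_mem
      (chartSquare_eventuallyEq_zero u fun hK => hy (chartSupport_subset a hK)) hyr

/-- With ρ the partition function, ∂₀(ρu)² = 2ρ (u · ρ∂₀u + u² ∂₀ρ). The square of ρ is what leaves
a factor ρ after differentiation, as needed to return to the volume measure of the chart piece. -/
lemma exists_enorm_pd_chartSquare_le (a : M) : ∃ C : ℝ, 0 < C ∧ ∀ u : M → ℝ, IsSmooth n u →
    ∀ y, ‖pd 0 (chartSquare (n := n) a u) y‖ₑ ≤ ENNReal.ofReal C *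
      (extChartAt (𝓡∂ n) a).target.indicator (fun y =>
        ENNReal.ofReal (chartPartition n M a ((extChartAt (𝓡∂ n) a).symm y)) *
        (‖u ((extChartAt (𝓡∂ n) a).symm y)‖ₑ ^ 2 + ‖u ((extChartAt (𝓡∂ n) a).symm y)‖ₑ *
          ‖localizedDeriv (n := n) a u ((extChartAt (𝓡∂ n) a).symm y)‖ₑ)) y := by
  obtain ⟨C, hC0, hC⟩ := exists_bound_of_continuousOn (isCompact_chartSupport (n := n) a)
    (chartSupport_subset a) (continuousOn_pd_comp_extChartAt_symm (isSmooth_chartPartition a) a 0)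
  -- `C` bounds ∂₀ρ on the support, the summand 1 accounts for the term with ∂₀u, and 2 comes from
  -- differentiating a square.
  refine ⟨2 * (C + 1), by positivity, fun u hu y => ?_⟩
  by_cases hK : y ∈ chartSupport a
  swap
  · have : pd 0 (chartSquare (n := n) a u) y = 0 := by
      rw [pd, (chartSquare_eventuallyEq_zero u hK).fderivWithin_eq (chartSquare_eq_zero u hK)]
      simp
    rw [this]
    simp
  have hy := chartSupport_subset a hK
  have hyr := extChartAt_target_subset_range a hy
  have h1 := (contDiffWithinAt_comp_extChartAt_symm (isSmooth_chartPartition a) a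
    hy).differentiableWithinAt (by simp)
  have h2 := (contDiffWithinAt_comp_extChartAt_symm hu a hy).differentiableWithinAt (by simp)
  have hpd : pd 0 (chartSquare (n := n) a u) y =
      2 * (chartPartition n M a ((extChartAt (𝓡∂ n) a).symm y) *
        (u ((extChartAt (𝓡∂ n) a).symm y) * localizedDeriv (n := n) a u ((extChartAt (𝓡∂ n) a).symm y)
        + u ((extChartAt (𝓡∂ n) a).symm y) ^ 2 *
          pd 0 (chartPartition n M a ∘ (extChartAt (𝓡∂ n) a).symm) y)) := by
    rw [pd, (chartSquare_eventuallyEq u hy).fderivWithin_eq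
      ((chartSquare_eventuallyEq u hy).eq_of_nhdsWithin hyr), ← pd,
      pd_mul hyr (h1.fun_mul h2) (h1.fun_mul h2), pd_mul hyr h1 h2, localizedDeriv, diff_coordVec hu a hy]
    simp only [Function.comp_apply]
    ring
  have hr := (chartPartition n M).nonneg a ((extChartAt (𝓡∂ n) a).symm y)
  rw [hpd, indicator_of_mem hy]
  set r := chartPartition n M a ((extChartAt (𝓡∂ n) a).symm y)
  set U := u ((extChartAt (𝓡∂ n) a).symm y)
  set D := localizedDeriv (n := n) a u ((extChartAt (𝓡∂ n) a).symm y)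
  have hR := hC y hK
  set R := pd 0 (chartPartition n M a ∘ (extChartAt (𝓡∂ n) a).symm) y
  simp only [Real.enorm_eq_ofReal_abs]
  rw [← ENNReal.ofReal_pow (abs_nonneg _), ← ENNReal.ofReal_mul (abs_nonneg _),
    ← ENNReal.ofReal_add (by positivity) (by positivity), ← ENNReal.ofReal_mul hr,
    ← ENNReal.ofReal_mul (by positivity)]
  refine ENNReal.ofReal_le_ofReal ?_
  rw [abs_mul, abs_mul, abs_of_nonneg hr, abs_two]
  have hb : |U * D + U ^ 2 * R| ≤ (C + 1) * (|U| ^ 2 + |U| * |D|) := by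
    calc |U * D + U ^ 2 * R| ≤ |U| * |D| + |U| ^ 2 * |R| := by
          refine (abs_add_le _ _).trans ?_
          rw [abs_mul, abs_mul, abs_pow]
      _ ≤ |U| * |D| + |U| ^ 2 * C := by gcongr
      _ ≤ _ := by nlinarith [mul_nonneg (abs_nonneg U) (abs_nonneg D), sq_nonneg |U|]
  calc 2 * (r * |U * D + U ^ 2 * R|) ≤ 2 * (r * ((C + 1) * (|U| ^ 2 + |U| * |D|))) := by gcongr
    _ = _ := by ring

/-- The local trace inequality for smooth functions. -/
lemma exists_lintegral_areaPiece_sq_le (g : Metric n M) (a : M) :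
    ∃ C : ℝ, ∀ u : M → ℝ, IsSmooth n u →
      ∫⁻ p, ENNReal.ofReal (chartPartition n M a p) * ‖u p‖ₑ ^ 2 ∂(areaPiece g a) ≤
        ENNReal.ofReal C *
          ∫⁻ p, (‖u p‖ₑ ^ 2 + ‖u p‖ₑ * ‖localizedDeriv (n := n) a u p‖ₑ) ∂(riemVolume g) := by
  obtain ⟨C₁, hC₁⟩ := exists_lintegral_areaPiece_le g a
  obtain ⟨C₂, hC₂0, hC₂⟩ := exists_enorm_pd_chartSquare_le (n := n) a
  obtain ⟨C₃, hC₃⟩ := exists_le_lintegral_volPiece g a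
  refine ⟨|C₁| * C₂ * |C₃|, fun u hu => ?_⟩
  have hum : Measurable fun p => ‖u p‖ₑ := hu.continuous.measurable.enorm
  have hdm : Measurable fun p => ‖localizedDeriv (n := n) a u p‖ₑ :=
    (measurable_localizedDeriv hu a).enorm
  have hT := measurableSet_extChartAt_target (n := n) a
  calc ∫⁻ p, ENNReal.ofReal (chartPartition n M a p) * ‖u p‖ₑ ^ 2 ∂(areaPiece g a)
      ≤ ENNReal.ofReal C₁ * ∫⁻ z in bdTarget a, ‖chartSquare a u (bdPoint z)‖ₑ := by
        refine (hC₁ _ ((measurable_chartPartition a).mul (hum.pow_const 2))).trans ?_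
        refine mul_le_mul_right ?_ _
        -- One factor of the partition function comes from the measure and one from the integrand;
        -- together they form the square (ρu)².
        refine setLIntegral_mono' (measurableSet_bdTarget a) fun z hz => le_of_eq ?_
        rw [chartSquare, indicator_of_mem (show bdPoint z ∈ (extChartAt (𝓡∂ n) a).target from hz)]
        simp only [Function.comp_apply, enorm_mul, Pi.mul_apply]
        rw [Real.enorm_of_nonneg ((chartPartition n M).nonneg a _)]
        ring
    _ ≤ ENNReal.ofReal C₁ * ∫⁻ z, ‖chartSquare a u (bdPoint z)‖ₑ := by
        gcongr
        exact Measure.restrict_le_self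
    _ ≤ ENNReal.ofReal C₁ * ∫⁻ y in range (𝓡∂ n), ‖pd 0 (chartSquare (n := n) a u) y‖ₑ := by
        gcongr
        exact lintegral_bdPoint_le (isCompact_chartSupport a)
          (fun y _ hK => chartSquare_eq_zero u hK) (contDiffOn_chartSquare a hu)
    _ ≤ ENNReal.ofReal C₁ * (ENNReal.ofReal C₂ * (ENNReal.ofReal C₃ *
          ∫⁻ p, (‖u p‖ₑ ^ 2 + ‖u p‖ₑ * ‖localizedDeriv (n := n) a u p‖ₑ) ∂(volPiece g a))) := by
        gcongr
        refine (lintegral_mono (hC₂ u hu)).trans ?_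
        rw [lintegral_const_mul' _ _ ENNReal.ofReal_ne_top]
        gcongr
        refine (setLIntegral_le_lintegral _ _).trans ?_
        rw [lintegral_indicator hT]
        exact hC₃ _ ((hum.pow_const 2).add (hum.mul hdm))
    _ ≤ ENNReal.ofReal |C₁| * (ENNReal.ofReal C₂ * (ENNReal.ofReal |C₃| *
          ∫⁻ p, (‖u p‖ₑ ^ 2 + ‖u p‖ₑ * ‖localizedDeriv (n := n) a u p‖ₑ) ∂(riemVolume g))) := by
        gcongr
        · exact le_abs_self _
        · exact le_abs_self _
        · exact volPiece_le g a
    _ = _ := by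
        rw [ENNReal.ofReal_mul (by positivity), ENNReal.ofReal_mul (by positivity)]
        ring

end ChartTrace

/-! ### Elementary L² estimates. -/

section LTwo

variable {Ω : Type*} [MeasurableSpace Ω] {μ : Measure Ω}

lemma eLpNorm_two_sq (f : Ω → ℝ) : eLpNorm f 2 μ ^ 2 = ∫⁻ x, ‖f x‖ₑ ^ 2 ∂μ := by
  rw [eLpNorm_eq_lintegral_rpow_enorm_toReal (by simp) (by simp), ← ENNReal.rpow_natCast,
    ← ENNReal.rpow_mul]
  simp

lemma lintegral_enorm_mul_le {f h : Ω → ℝ} (hf : AEMeasurable f μ) (hh : AEMeasurable h μ) :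
    ∫⁻ x, ‖f x‖ₑ * ‖h x‖ₑ ∂μ ≤ eLpNorm f 2 μ * eLpNorm h 2 μ := by
  refine (ENNReal.lintegral_mul_le_Lp_mul_Lq μ Real.HolderConjugate.two_two hf.enorm hh.enorm).trans
    (le_of_eq ?_)
  rw [eLpNorm_eq_lintegral_rpow_enorm_toReal (by simp) (by simp),
    eLpNorm_eq_lintegral_rpow_enorm_toReal (by simp) (by simp)]
  simp

lemma enorm_sq_le_two_mul (x y : ℝ) : ‖y‖ₑ ^ 2 ≤ 2 * ‖x - y‖ₑ ^ 2 + 2 * ‖x‖ₑ ^ 2 := by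
  simp only [Real.enorm_eq_ofReal_abs]
  rw [← ENNReal.ofReal_pow (abs_nonneg _), ← ENNReal.ofReal_pow (abs_nonneg _),
    ← ENNReal.ofReal_pow (abs_nonneg _), ← ENNReal.ofReal_ofNat 2, ← ENNReal.ofReal_mul (by simp),
    ← ENNReal.ofReal_mul (by simp), ← ENNReal.ofReal_add (by positivity) (by positivity)]
  refine ENNReal.ofReal_le_ofReal ?_
  simp only [sq_abs]
  nlinarith [sq_nonneg (2 * x - y)]

end LTwo

/-! ### Localized components of a vector field: measurability and L² control. -/

section LocalizedComponent

variable {n : ℕ} [NeZero n] {M : Type*} [TopologicalSpace M]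
  [ChartedSpace (EuclideanHalfSpace n) M] [IsManifold (𝓡∂ n) ∞ M]

/-- Cauchy–Schwarz, from the nonnegativity of the squared length of ⟨y, y⟩ x - ⟨x, y⟩ y. -/
lemma inner_sq_le (g : Metric n M) (p : M) (x y : TangentSpace (𝓡∂ n) p) :
    g.inner p x y ^ 2 ≤ g.inner p x x * g.inner p y y := by
  by_cases hy : y = 0
  · simp [hy]
  have hpos := g.pos p y hy
  have h0 : 0 ≤ g.inner p (g.inner p y y • x - g.inner p x y • y)
      (g.inner p y y • x - g.inner p x y • y) := by
    by_cases h : g.inner p y y • x - g.inner p x y • y = 0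
    · simp [h]
    · exact (g.pos p _ h).le
  simp only [map_sub, map_smul, sub_apply, smul_apply, smul_eq_mul, g.symm p y x] at h0
  have h1 : 0 ≤ g.inner p y y * (g.inner p x x * g.inner p y y - g.inner p x y ^ 2) := by
    calc _ ≤ _ := h0
      _ = _ := by ring
  linarith [nonneg_of_mul_nonneg_right h1 hpos]

variable [T2Space M] [CompactSpace M]

/-- The `i`-th coordinate of the chart at `a`, multiplied by a function of the partition of unity. -/
def localizedCoord (a : M) (i : Fin n) (p : M) : ℝ :=
  chartPartition n M a p * extChartAt (𝓡∂ n) a p i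

/-- Weak gradients are only known to be measurable when paired with globally smooth functions, so
the chart coordinates must be cut off before they can be used as test functions. -/
lemma isSmooth_localizedCoord (a : M) (i : Fin n) : IsSmooth n (localizedCoord a i) := by
  refine contMDiff_of_tsupport fun p hp => ?_
  have hps := tsupport_chartPartition_subset a (tsupport_mul_subset_left hp)
  have h1 : ContMDiffAt (𝓡∂ n) 𝓘(ℝ, EuclideanSpace ℝ (Fin n)) ∞ (extChartAt (𝓡∂ n) a) p :=
    contMDiffAt_extChartAt' (by rwa [← extChartAt_source (𝓡∂ n)])
  have h2 : ContMDiffAt (𝓡∂ n) 𝓘(ℝ, ℝ) ∞ (fun p => extChartAt (𝓡∂ n) a p i) p :=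
    (((EuclideanSpace.proj i : EuclideanSpace ℝ (Fin n) →L[ℝ] ℝ).contDiff
      (n := ∞)).contMDiff.contMDiffAt).comp p h1
  exact (isSmooth_chartPartition a p).mul h2

lemma diff_localizedCoord_chartFrame (a : M) (i j : Fin n) {p : M}
    (hp : p ∈ (extChartAt (𝓡∂ n) a).source) :
    diff (n := n) (localizedCoord a i) p (chartFrame a p j) =
      (if j = i then chartPartition n M a p else 0) +
        extChartAt (𝓡∂ n) a p i * diff (n := n) (chartPartition n M a) p (chartFrame a p j) := by
  have hy := (extChartAt (𝓡∂ n) a).map_source hp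
  have hyr := extChartAt_target_subset_range a hy
  have h1 := diff_coordVec (isSmooth_localizedCoord a i) a hy j
  have h2 := diff_coordVec (isSmooth_chartPartition a) a hy j
  rw [(extChartAt (𝓡∂ n) a).left_inv hp] at h1 h2
  rw [h1, h2]
  have heq : localizedCoord a i ∘ (extChartAt (𝓡∂ n) a).symm =ᶠ[𝓝[range (𝓡∂ n)] (extChartAt (𝓡∂ n) a p)]
      fun y => y i * (chartPartition n M a ∘ (extChartAt (𝓡∂ n) a).symm) y := by
    filter_upwards [extChartAt_target_mem_nhdsWithin_of_mem hy] with z hz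
    simp only [Function.comp_apply, localizedCoord, (extChartAt (𝓡∂ n) a).right_inv hz]
    ring
  have hproj : HasFDerivWithinAt (fun y : EuclideanSpace ℝ (Fin n) => y i)
      (EuclideanSpace.proj i : EuclideanSpace ℝ (Fin n) →L[ℝ] ℝ) (range (𝓡∂ n))
      (extChartAt (𝓡∂ n) a p) :=
    (EuclideanSpace.proj i : EuclideanSpace ℝ (Fin n) →L[ℝ] ℝ).hasFDerivWithinAt
  have hpd : pd j (fun y : EuclideanSpace ℝ (Fin n) => y i) (extChartAt (𝓡∂ n) a p) =
      if j = i then 1 else 0 := by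
    rw [pd, hproj.fderivWithin ((𝓡∂ n).uniqueDiffOn _ hyr)]
    simp [eq_comm]
  rw [pd, heq.fderivWithin_eq (heq.eq_of_nhdsWithin hyr), ← pd,
    pd_mul hyr hproj.differentiableWithinAt
      ((contDiffWithinAt_comp_extChartAt_symm (isSmooth_chartPartition a) a
        hy).differentiableWithinAt (by simp)), hpd]
  simp only [Function.comp_apply, (extChartAt (𝓡∂ n) a).left_inv hp]
  split_ifs <;> ring

lemma exists_eq_sum_chartFrame {a p : M} (hp : p ∈ (extChartAt (𝓡∂ n) a).source)
    (Y : TangentSpace (𝓡∂ n) p) : ∃ c : Fin n → ℝ, Y = ∑ i, c i • chartFrame a p i := by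
  have hb : p ∈ (trivializationAt (EuclideanSpace ℝ (Fin n)) (TangentSpace (𝓡∂ n)) a).baseSet := by
    simpa using hp
  refine ⟨fun i => (trivializationAt (EuclideanSpace ℝ (Fin n))
    (TangentSpace (𝓡∂ n)) a).continuousLinearMapAt ℝ p Y i, ?_⟩
  rw [sum_smul_chartFrame, Bundle.Trivialization.symmL_continuousLinearMapAt (R := ℝ) _ hb]

/-- The component of a vector field along the zeroth coordinate field of the chart at `a`,
localized by the partition of unity. -/
def localizedComponent (g : Metric n M) (a : M) (Y : ∀ p : M, TangentSpace (𝓡∂ n) p) (p : M) : ℝ :=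
  chartPartition n M a p * g.inner p (Y p) (chartFrame a p 0)

lemma localizedComponent_gradient (g : Metric n M) (a : M) (u : M → ℝ) :
    localizedComponent g a (gradient g u) = localizedDeriv (n := n) a u := by
  ext p
  rw [localizedComponent, inner_gradient, localizedDeriv]

/-- By the product rule d(ρxᵢ) - xᵢ dρ = ρ dxᵢ, so the components of ρY in the frame are recovered
from differentials of global smooth functions. -/
lemma localizedComponent_eq (g : Metric n M) (a : M) (Y : ∀ p : M, TangentSpace (𝓡∂ n) p) {p : M}
    (hp : p ∈ (extChartAt (𝓡∂ n) a).source) :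
    localizedComponent g a Y p = ∑ i, (diff (n := n) (localizedCoord a i) p (Y p) -
      extChartAt (𝓡∂ n) a p i * diff (n := n) (chartPartition n M a) p (Y p)) *
      g.inner p (chartFrame a p i) (chartFrame a p 0) := by
  obtain ⟨c, hc⟩ := exists_eq_sum_chartFrame hp (Y p)
  have hlin : ∀ f : M → ℝ, diff (n := n) f p (Y p) = ∑ j, c j * diff (n := n) f p (chartFrame a p j) := by
    intro f
    rw [hc]
    have : ∀ L : TangentSpace (𝓡∂ n) p →L[ℝ] ℝ, L (∑ i, c i • chartFrame a p i) =
        ∑ j, c j * L (chartFrame a p j) := fun L => by simp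
    exact this (mfderiv (𝓡∂ n) 𝓘(ℝ, ℝ) f p)
  have hcoef : ∀ i, diff (n := n) (localizedCoord a i) p (Y p) -
      extChartAt (𝓡∂ n) a p i * diff (n := n) (chartPartition n M a) p (Y p) =
      chartPartition n M a p * c i := by
    intro i
    rw [hlin, hlin]
    simp only [diff_localizedCoord_chartFrame a i _ hp, mul_add, Finset.sum_add_distrib,
      Finset.mul_sum]
    rw [add_sub_assoc, ← Finset.sum_sub_distrib,
      Finset.sum_eq_zero (s := Finset.univ) (f := fun j => c j * (extChartAt (𝓡∂ n) a p i * _) - _)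
        fun j _ => by ring]
    simp [mul_comm]
  simp only [hcoef]
  rw [localizedComponent, hc]
  simp [Finset.mul_sum, mul_assoc]

/-- Cauchy–Schwarz, with the squared length of the frame vector bounded on the compact support of
the partition function, which is itself at most 1. -/
lemma exists_localizedComponent_sq_le (g : Metric n M) (a : M) :
    ∃ C : ℝ, 0 < C ∧ ∀ (Y : ∀ p : M, TangentSpace (𝓡∂ n) p) (p : M),
      localizedComponent g a Y p ^ 2 ≤ C * normSq g p (Y p) := by
  obtain ⟨C, hC0, hC⟩ := exists_bound_of_continuousOn
    (isClosed_tsupport (chartPartition n M a)).isCompact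
    (by rw [← extChartAt_source (𝓡∂ n)]; exact tsupport_chartPartition_subset a)
    (continuousOn_inner_chartFrame g a 0 0)
  refine ⟨C, hC0, fun Y p => ?_⟩
  have hn : 0 ≤ normSq g p (Y p) := by
    by_cases h : Y p = 0
    · simp [normSq, h]
    · exact (g.pos p _ h).le
  by_cases hp : p ∈ tsupport (chartPartition n M a)
  · have h1 := (chartPartition n M).le_one a p
    have h0 := (chartPartition n M).nonneg a p
    have h2 : chartPartition n M a p ^ 2 ≤ 1 := pow_le_one₀ h0 h1
    have h3 := inner_sq_le g p (Y p) (chartFrame a p 0)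
    have h4 := (le_abs_self _).trans (hC p hp)
    rw [localizedComponent, mul_pow]
    calc _ ≤ 1 * g.inner p (Y p) (chartFrame a p 0) ^ 2 := by gcongr
      _ ≤ normSq g p (Y p) * g.inner p (chartFrame a p 0) (chartFrame a p 0) := by
          rw [one_mul]; exact h3
      _ ≤ normSq g p (Y p) * C := by gcongr
      _ = _ := mul_comm _ _
  · rw [localizedComponent, image_eq_zero_of_notMem_tsupport hp]
    simpa using mul_nonneg hC0.le hn

variable [MeasurableSpace M] [BorelSpace M]

lemma aestronglyMeasurable_localizedComponent (g : Metric n M) (a : M) {μ : Measure M}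
    {Y : ∀ p : M, TangentSpace (𝓡∂ n) p}
    (hY : ∀ f : M → ℝ, IsSmooth n f → AEStronglyMeasurable (fun p => diff (n := n) f p (Y p)) μ) :
    AEStronglyMeasurable (localizedComponent g a Y) μ := by
  have hs := (isOpen_extChartAt_source (I := 𝓡∂ n) a).measurableSet
  have hind : localizedComponent g a Y = (extChartAt (𝓡∂ n) a).source.indicator fun p =>
      ∑ i, (diff (n := n) (localizedCoord a i) p (Y p) -
      extChartAt (𝓡∂ n) a p i * diff (n := n) (chartPartition n M a) p (Y p)) *
      g.inner p (chartFrame a p i) (chartFrame a p 0) := by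
    ext p
    by_cases hp : p ∈ (extChartAt (𝓡∂ n) a).source
    · rw [indicator_of_mem hp, localizedComponent_eq g a Y hp]
    · rw [indicator_of_notMem hp, localizedComponent, chartPartition_eq_zero hp, zero_mul]
  rw [hind, aestronglyMeasurable_indicator_iff hs]
  refine Finset.aestronglyMeasurable_fun_sum _ fun i _ => ?_
  have hx : ContinuousOn (fun p => extChartAt (𝓡∂ n) a p i) (extChartAt (𝓡∂ n) a).source :=
    (EuclideanSpace.proj i : EuclideanSpace ℝ (Fin n) →L[ℝ] ℝ).continuous.comp_continuousOn
      (continuousOn_extChartAt a)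
  have hg : ContinuousOn (fun p => g.inner p (chartFrame a p i) (chartFrame a p 0))
      (extChartAt (𝓡∂ n) a).source := by
    rw [extChartAt_source]; exact continuousOn_inner_chartFrame g a i 0
  exact (((hY _ (isSmooth_localizedCoord a i)).restrict).sub
    ((hx.aestronglyMeasurable hs).mul (hY _ (isSmooth_chartPartition a)).restrict)).mul
    (hg.aestronglyMeasurable hs)

end LocalizedComponent

/-! ### A Sobolev function that vanishes in the interior has zero trace. -/

namespace SmoothMMS

variable {n : ℕ} [NeZero n] {M : Type*} [TopologicalSpace M]
  [ChartedSpace (EuclideanHalfSpace n) M] [IsManifold (𝓡∂ n) ∞ M]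
  [MeasurableSpace M] [BorelSpace M] [T2Space M] [CompactSpace M]

lemma exists_riemVolume_le (X : SmoothMMS n M) :
    ∃ C : ℝ, riemVolume X.g ≤ ENNReal.ofReal C • X.vol :=
  X.exists_withDensity_le.imp fun _ hC => (hC (riemVolume X.g)).2

lemma exists_riemArea_le (X : SmoothMMS n M) :
    ∃ C : ℝ, riemArea X.g ≤ ENNReal.ofReal C • X.area :=
  X.exists_withDensity_le.imp fun _ hC => (hC (riemArea X.g)).2

lemma tendsto_eLpNorm_localizedDeriv_sub (X : SmoothMMS n M) (a : M)
    {Y : ∀ p : M, TangentSpace (𝓡∂ n) p} {u : ℕ → M → ℝ}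
    (h : Tendsto (fun k => ∫⁻ p, ENNReal.ofReal (normSq X.g p (gradient X.g (u k) p - Y p)) ∂X.vol)
      atTop (𝓝 0)) :
    Tendsto (fun k => eLpNorm (localizedDeriv (n := n) a (u k) - localizedComponent X.g a Y) 2 X.vol)
      atTop (𝓝 0) := by
  obtain ⟨C, hC0, hC⟩ := exists_localizedComponent_sq_le X.g a
  have hsq : Tendsto (fun k =>
      eLpNorm (localizedDeriv (n := n) a (u k) - localizedComponent X.g a Y) 2 X.vol ^ 2)
      atTop (𝓝 0) := by
    have h' := ENNReal.Tendsto.const_mul h (Or.inr (ENNReal.ofReal_ne_top (r := C)))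
    rw [mul_zero] at h'
    refine tendsto_of_tendsto_of_tendsto_of_le_of_le tendsto_const_nhds h' (fun k => zero_le)
      fun k => ?_
    dsimp only
    rw [eLpNorm_two_sq, ← lintegral_const_mul' _ _ ENNReal.ofReal_ne_top]
    refine lintegral_mono fun p => ?_
    have h1 : (localizedDeriv (n := n) a (u k) - localizedComponent X.g a Y) p =
        localizedComponent X.g a (fun p => gradient X.g (u k) p - Y p) p := by
      rw [← localizedComponent_gradient X.g]
      simp only [Pi.sub_apply, localizedComponent, map_sub, sub_apply]
      ring
    rw [h1, Real.enorm_eq_ofReal_abs, ← ENNReal.ofReal_pow (abs_nonneg _), sq_abs,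
      ← ENNReal.ofReal_mul hC0.le]
    exact ENNReal.ofReal_le_ofReal (hC _ p)
  have := hsq.ennrpow_const (1 / 2 : ℝ)
  simpa [← ENNReal.rpow_natCast_mul] using this

/-- By Hölder the mixed term is at most the L² norm of `u k`, which tends to 0, times that of the
localized derivative, which only has to stay bounded. The limit field `Y` need not vanish. -/
lemma tendsto_lintegral_mul_localizedDeriv (X : SmoothMMS n M) (a : M)
    {Y : ∀ p : M, TangentSpace (𝓡∂ n) p} {u : ℕ → M → ℝ} (hu : ∀ k, IsSmooth n (u k))
    (hY : ∀ f : M → ℝ, IsSmooth n f →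
      AEStronglyMeasurable (fun p => diff (n := n) f p (Y p)) X.vol)
    (h : Tendsto (fun k => ∫⁻ p, ENNReal.ofReal (normSq X.g p (gradient X.g (u k) p - Y p)) ∂X.vol)
      atTop (𝓝 0))
    (h0 : Tendsto (fun k => eLpNorm (u k) 2 X.vol) atTop (𝓝 0)) :
    Tendsto (fun k => ∫⁻ p, (‖u k p‖ₑ ^ 2 + ‖u k p‖ₑ * ‖localizedDeriv (n := n) a (u k) p‖ₑ) ∂X.vol)
      atTop (𝓝 0) := by
  have hd := X.tendsto_eLpNorm_localizedDeriv_sub a h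
  have hm := aestronglyMeasurable_localizedComponent X.g a hY
  have hdm : ∀ k, AEStronglyMeasurable (localizedDeriv (n := n) a (u k)) X.vol :=
    fun k => (measurable_localizedDeriv (hu k) a).aestronglyMeasurable
  have hev : ∀ᶠ k in atTop,
      eLpNorm (localizedDeriv (n := n) a (u k) - localizedComponent X.g a Y) 2 X.vol < 1 :=
    hd.eventually (gt_mem_nhds one_pos)
  obtain ⟨K, hK⟩ := hev.exists
  -- The limit component is square integrable because it is at finite L² distance from the bounded
  -- localized derivative of the single function `u K`.
  have hL2 : eLpNorm (localizedComponent X.g a Y) 2 X.vol < ⊤ := by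
    have h1 : localizedComponent X.g a Y = localizedDeriv (n := n) a (u K) -
        (localizedDeriv (n := n) a (u K) - localizedComponent X.g a Y) := by abel
    rw [h1]
    refine (eLpNorm_sub_le (hdm K) ((hdm K).sub hm) (by simp)).trans_lt ?_
    exact ENNReal.add_lt_top.2 ⟨(memLp_localizedDeriv (hu K) a X.vol).2,
      hK.trans ENNReal.one_lt_top⟩
  set B := 1 + eLpNorm (localizedComponent X.g a Y) 2 X.vol with hB
  have hBtop : B ≠ ⊤ := (ENNReal.add_lt_top.2 ⟨ENNReal.one_lt_top, hL2⟩).ne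
  have hlim : Tendsto (fun k => eLpNorm (u k) 2 X.vol ^ 2 + eLpNorm (u k) 2 X.vol * B)
      atTop (𝓝 0) := by
    have h1 := (ENNReal.Tendsto.pow (n := 2) h0).add (ENNReal.Tendsto.mul_const h0 (Or.inr hBtop))
    simpa using h1
  refine tendsto_of_tendsto_of_tendsto_of_le_of_le' tendsto_const_nhds hlim
    (.of_forall fun k => zero_le) ?_
  filter_upwards [hev] with k hk
  have hum : Measurable (u k) := (hu k).continuous.measurable
  rw [lintegral_add_left (hum.enorm.pow_const 2), eLpNorm_two_sq]
  refine add_le_add_right ?_ _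
  refine (lintegral_enorm_mul_le hum.aemeasurable (hdm k).aemeasurable).trans ?_
  gcongr
  have h1 : localizedDeriv (n := n) a (u k) =
      (localizedDeriv (n := n) a (u k) - localizedComponent X.g a Y) +
        localizedComponent X.g a Y := by abel
  rw [h1]
  refine (eLpNorm_add_le ((hdm k).sub hm) hm (by simp)).trans ?_
  rw [hB]
  gcongr

/-- The trace of an element of `H¹` that vanishes in the interior vanishes. -/
lemma H1.trace_ae_eq_zero {X : SmoothMMS n M} (w : X.H1) (hw : w.w =ᵐ[X.vol] 0) :
    w.trace =ᵐ[X.area] 0 := by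
  obtain ⟨u, hu, hu1, hu2, hu3⟩ := w.exists_approx
  have hu0 : Tendsto (fun k => eLpNorm (u k) 2 X.vol) atTop (𝓝 0) := by
    refine hu1.congr fun k => eLpNorm_congr_ae ?_
    filter_upwards [hw] with p hp
    simp [hp]
  obtain ⟨Cv, hCv⟩ := X.exists_riemVolume_le
  obtain ⟨Ca, hCa⟩ := X.exists_riemArea_le
  have htr : AEStronglyMeasurable w.trace (riemArea X.g) :=
    (w.memLp_trace.1.smul_measure (ENNReal.ofReal Ca)).mono_measure hCa
  have hpiece : ∀ a, ∀ᵐ p ∂(areaPiece X.g a), w.trace p = 0 := by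
    intro a
    have htra := htr.mono_measure (areaPiece_le X.g a)
    obtain ⟨C, hC⟩ := exists_lintegral_areaPiece_sq_le X.g a
    have hI : Tendsto (fun k => ∫⁻ p, ENNReal.ofReal (chartPartition n M a p) * ‖u k p‖ₑ ^ 2
        ∂(areaPiece X.g a)) atTop (𝓝 0) := by
      have h1 := X.tendsto_lintegral_mul_localizedDeriv a hu w.grad_meas hu2 hu0
      have h2 := ENNReal.Tendsto.const_mul (a := ENNReal.ofReal C * ENNReal.ofReal Cv) h1
        (Or.inr (ENNReal.mul_ne_top ENNReal.ofReal_ne_top ENNReal.ofReal_ne_top))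
      rw [mul_zero] at h2
      refine tendsto_of_tendsto_of_tendsto_of_le_of_le tendsto_const_nhds h2 (fun k => zero_le)
        fun k => (hC (u k) (hu k)).trans ?_
      rw [mul_assoc]
      refine mul_le_mul_right ?_ _
      refine (lintegral_mono' hCv le_rfl).trans ?_
      rw [lintegral_smul_measure, smul_eq_mul]
    have hJ : Tendsto (fun k => ∫⁻ p, ENNReal.ofReal (chartPartition n M a p) *
        ‖u k p - w.trace p‖ₑ ^ 2 ∂(areaPiece X.g a)) atTop (𝓝 0) := by
      have h2 := ENNReal.Tendsto.const_mul (a := ENNReal.ofReal Ca)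
        (ENNReal.Tendsto.pow (n := 2) hu3) (Or.inr ENNReal.ofReal_ne_top)
      rw [zero_pow two_ne_zero, mul_zero] at h2
      refine tendsto_of_tendsto_of_tendsto_of_le_of_le tendsto_const_nhds h2 (fun k => zero_le)
        fun k => ?_
      dsimp only
      rw [eLpNorm_two_sq, ← smul_eq_mul, ← lintegral_smul_measure]
      refine lintegral_mono' ((areaPiece_le X.g a).trans hCa) fun p => ?_
      exact mul_le_of_le_one_left' (by simpa using (chartPartition n M).le_one a p)
    -- The trace is compared with `u k`: the difference tends to 0 by the definition of the trace,
    -- and `u k` itself by the local trace inequality.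
    have hzero : ∫⁻ p, ENNReal.ofReal (chartPartition n M a p) * ‖w.trace p‖ₑ ^ 2
        ∂(areaPiece X.g a) = 0 := by
      have h2 := (ENNReal.Tendsto.const_mul (a := 2) hJ (Or.inr (by simp))).add
        (ENNReal.Tendsto.const_mul (a := 2) hI (Or.inr (by simp)))
      rw [mul_zero, add_zero] at h2
      refine le_antisymm (ge_of_tendsto' h2 fun k => ?_) zero_le
      have hum : Measurable fun p => ENNReal.ofReal (chartPartition n M a p) * ‖u k p‖ₑ ^ 2 :=
        (measurable_chartPartition a).mul ((hu k).continuous.measurable.enorm.pow_const 2)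
      rw [← lintegral_const_mul' _ _ (by simp), ← lintegral_const_mul' _ _ (by simp),
        ← lintegral_add_right _ (hum.const_mul 2)]
      refine lintegral_mono fun p => ?_
      calc _ ≤ ENNReal.ofReal (chartPartition n M a p) *
            (2 * ‖u k p - w.trace p‖ₑ ^ 2 + 2 * ‖u k p‖ₑ ^ 2) := by
            gcongr; exact enorm_sq_le_two_mul _ _
        _ = _ := by ring
    have hae := (lintegral_eq_zero_iff' (((measurable_chartPartition a).aemeasurable).mul
      (htra.aemeasurable.enorm.pow_const 2))).1 hzero
    -- The piece has the partition function as a density, so the zeros of that function form a null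
    -- set and the weight can be cancelled.
    have hpos : ∀ᵐ p ∂(areaPiece X.g a), ENNReal.ofReal (chartPartition n M a p) ≠ 0 :=
      (ae_withDensity_iff (measurable_chartPartition a)).2 (.of_forall fun _ h => h)
    filter_upwards [hae, hpos] with p h1 h2
    simpa [h2] using h1
  obtain ⟨s, hs⟩ := exists_finset_volPiece_areaPiece n M X.g
  have hall : ∀ᵐ p ∂(riemArea X.g), w.trace p = 0 :=
    ae_sum_of_finset s (fun a ha => (hs a ha).2) hpiece
  exact (withDensity_absolutelyContinuous (riemArea X.g) _).ae_le hall

end SmoothMMS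

/-! ### Minimization in τ and its exchange with the infimum over functions. -/

section Minimization

variable {m N A B τ : ℝ}

/-- The minimum over `τ` of `τ ^ (m / (2 N)) A + τ ^ (-1/2) B - 1` as a function of
`x = A B ^ (m / N)`. -/
def minValue (m N x : ℝ) : ℝ := (N + m) / m * (m * x / N) ^ (N / (N + m)) - 1

/-- The point at which the minimum is attained. -/
def minPoint (m N A B : ℝ) : ℝ := (N * B / (m * A)) ^ (2 * N / (N + m))

lemma minPoint_pos (hm : 0 < m) (hN : 0 < N) (hA : 0 < A) (hB : 0 < B) : 0 < minPoint m N A B :=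
  Real.rpow_pos_of_pos (by positivity) _

/-- The critical point equation: the τ-derivative of τ^(m/(2N)) A + τ^(-1/2) B vanishes exactly when
the two terms are in this proportion. -/
lemma minPoint_balance (hm : 0 < m) (hN : 0 < N) (hA : 0 < A) (hB : 0 < B) :
    m * (minPoint m N A B ^ (m / (2 * N)) * A) = N * (minPoint m N A B ^ (-(1 / 2) : ℝ) * B) := by
  have hp := minPoint_pos hm hN hA hB
  have h1 : minPoint m N A B ^ (m / (2 * N)) =
      minPoint m N A B ^ (-(1 / 2) : ℝ) * (N * B / (m * A)) := by
    have h2 : N * B / (m * A) = minPoint m N A B ^ (m / (2 * N) + 1 / 2) := by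
      rw [minPoint, ← Real.rpow_mul (by positivity)]
      have : 2 * N / (N + m) * (m / (2 * N) + 1 / 2) = 1 := by field_simp; ring
      rw [this, Real.rpow_one]
    rw [h2, ← Real.rpow_add hp]
    congr 1
    ring
  rw [h1]
  field_simp

/-- By the balance the first term is N/m times the second, so the sum is (N + m)/m times the second
term, and that term depends only on A B^(m/N). -/
lemma minPoint_value (hm : 0 < m) (hN : 0 < N) (hA : 0 < A) (hB : 0 < B) :
    minPoint m N A B ^ (m / (2 * N)) * A + minPoint m N A B ^ (-(1 / 2) : ℝ) * B - 1 =
      minValue m N (A * B ^ (m / N)) := by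
  have hbal := minPoint_balance hm hN hA hB
  have h1 : minPoint m N A B ^ (-(1 / 2) : ℝ) * B =
      (m * (A * B ^ (m / N)) / N) ^ (N / (N + m)) := by
    have h2 : minPoint m N A B ^ (-(1 / 2) : ℝ) = (m * A / (N * B)) ^ (N / (N + m)) := by
      rw [minPoint, ← Real.rpow_mul (by positivity), ← inv_div (N * B), Real.inv_rpow (by positivity),
        ← Real.rpow_neg (by positivity)]
      congr 1
      field_simp
    have h3 : B = (B ^ ((N + m) / N)) ^ (N / (N + m)) := by
      rw [← Real.rpow_mul hB.le]
      have : (N + m) / N * (N / (N + m)) = 1 := by field_simp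
      rw [this, Real.rpow_one]
    conv_lhs => rw [h2]; arg 2; rw [h3]
    rw [← Real.mul_rpow (by positivity) (by positivity)]
    congr 1
    have h4 : B ^ ((N + m) / N) = B * B ^ (m / N) := by
      rw [show (N + m) / N = 1 + m / N by field_simp, Real.rpow_add hB, Real.rpow_one]
    rw [h4]
    field_simp
  have h5 : minPoint m N A B ^ (m / (2 * N)) * A =
      N / m * (minPoint m N A B ^ (-(1 / 2) : ℝ) * B) := by
    field_simp
    linarith
  rw [h5, minValue, ← h1]
  field_simp

/-- In the variable τ = σ e^(2Nt), with σ the minimum point, the two terms are multiplied by e^(mt)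
and e^(-Nt). The strict inequality 1 + s < e^s applies to both, and the linear contributions cancel
by the balance. -/
lemma minValue_lt (hm : 0 < m) (hN : 0 < N) (hA : 0 < A) (hB : 0 < B) (hτ : 0 < τ)
    (hne : τ ≠ minPoint m N A B) :
    minValue m N (A * B ^ (m / N)) < τ ^ (m / (2 * N)) * A + τ ^ (-(1 / 2) : ℝ) * B - 1 := by
  have hp := minPoint_pos hm hN hA hB
  have hbal := minPoint_balance hm hN hA hB
  rw [← minPoint_value hm hN hA hB]
  set σ := minPoint m N A B
  set t := Real.log (τ / σ) / (2 * N) with ht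
  have hexp : τ = σ * Real.exp (2 * N * t) := by
    rw [ht, mul_div_cancel₀ _ (by positivity), Real.exp_log (by positivity)]
    field_simp
  have ht0 : t ≠ 0 := by
    intro h
    rw [h, mul_zero, Real.exp_zero, mul_one] at hexp
    exact hne hexp
  have h1 : τ ^ (m / (2 * N)) = σ ^ (m / (2 * N)) * Real.exp (m * t) := by
    rw [hexp, Real.mul_rpow hp.le (Real.exp_pos _).le, ← Real.exp_mul]
    congr 2
    field_simp
  have h2 : τ ^ (-(1 / 2) : ℝ) = σ ^ (-(1 / 2) : ℝ) * Real.exp (-(N * t)) := by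
    rw [hexp, Real.mul_rpow hp.le (Real.exp_pos _).le, ← Real.exp_mul]
    congr 2
    ring
  rw [h1, h2]
  have e1 := Real.add_one_lt_exp (mul_ne_zero hm.ne' ht0)
  have e2 := Real.add_one_lt_exp (neg_ne_zero.2 (mul_ne_zero hN.ne' ht0))
  have hx : 0 < σ ^ (m / (2 * N)) * A := by positivity
  have hy : 0 < σ ^ (-(1 / 2) : ℝ) * B := by positivity
  have i1 := mul_lt_mul_of_pos_left e1 hx
  have i2 := mul_lt_mul_of_pos_left e2 hy
  have i3 : σ ^ (m / (2 * N)) * A * (m * t) + σ ^ (-(1 / 2) : ℝ) * B * (-(N * t)) = 0 := by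
    linear_combination t * hbal
  linarith

lemma minValue_zero (hN : 0 < N) (hm : 0 < m) : minValue m N 0 = -1 := by
  have : N / (N + m) ≠ 0 := by positivity
  simp [minValue, Real.zero_rpow this]

lemma strictMonoOn_minValue (hm : 0 < m) (hN : 0 < N) : StrictMonoOn (minValue m N) (Ici 0) := by
  intro x hx y _ hxy
  have hx' : 0 ≤ x := hx
  unfold minValue
  have : (m * x / N) ^ (N / (N + m)) < (m * y / N) ^ (N / (N + m)) :=
    Real.rpow_lt_rpow (by positivity) (by gcongr) (by positivity)
  have := mul_lt_mul_of_pos_left this (show 0 < (N + m) / m by positivity)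
  linarith

lemma continuous_minValue (hm : 0 < m) (hN : 0 < N) : Continuous (minValue m N) := by
  unfold minValue
  exact (continuous_const.mul ((by fun_prop : Continuous fun x => m * x / N).rpow_const
    fun _ => Or.inr (by positivity))).sub continuous_const

lemma minValue_le (hm : 0 < m) (hN : 0 < N) (hA : 0 ≤ A) (hB : 0 < B) (hτ : 0 < τ) :
    minValue m N (A * B ^ (m / N)) ≤ τ ^ (m / (2 * N)) * A + τ ^ (-(1 / 2) : ℝ) * B - 1 := by
  rcases hA.eq_or_lt with rfl | hA
  · rw [zero_mul, minValue_zero hN hm]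
    have : 0 ≤ τ ^ (-(1 / 2) : ℝ) * B := by positivity
    linarith
  · by_cases h : τ = minPoint m N A B
    · rw [h, minPoint_value hm hN hA hB]
    · exact (minValue_lt hm hN hA hB hτ h).le

/-- Stated with a strict upper bound so as to include A = 0, where the infimum -1 is only approached
as τ → ∞. -/
lemma exists_lt_of_minValue_lt (hm : 0 < m) (hN : 0 < N) (hA : 0 ≤ A) (hB : 0 < B) {y : ℝ}
    (hy : minValue m N (A * B ^ (m / N)) < y) :
    ∃ τ, 0 < τ ∧ τ ^ (m / (2 * N)) * A + τ ^ (-(1 / 2) : ℝ) * B - 1 < y := by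
  rcases hA.eq_or_lt with rfl | hA
  · rw [zero_mul, minValue_zero hN hm] at hy
    have h1 : Tendsto (fun τ : ℝ => τ ^ (-(1 / 2) : ℝ) * B) atTop (𝓝 (0 * B)) :=
      (tendsto_rpow_neg_atTop (by norm_num)).mul_const B
    rw [zero_mul] at h1
    have h2 : (0 : ℝ) < y + 1 := by linarith
    obtain ⟨τ, hτ, hτ0⟩ := ((h1.eventually (gt_mem_nhds h2)).and (eventually_gt_atTop 0)).exists
    exact ⟨τ, hτ0, by linarith⟩
  · exact ⟨_, minPoint_pos hm hN hA hB, by rwa [minPoint_value hm hN hA hB]⟩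

/-- As τ → ∞ the energy term tends to -∞ and the term with B tends to 0. -/
lemma exists_lt_of_neg (hm : 0 < m) (hN : 0 < N) (hA : A < 0) (B y : ℝ) :
    ∃ τ, 0 < τ ∧ τ ^ (m / (2 * N)) * A + τ ^ (-(1 / 2) : ℝ) * B - 1 < y := by
  have h1 : Tendsto (fun τ : ℝ => τ ^ (m / (2 * N)) * A) atTop atBot :=
    (tendsto_rpow_atTop (by positivity)).atTop_mul_const_of_neg hA
  have h2 : Tendsto (fun τ : ℝ => τ ^ (-(1 / 2) : ℝ) * B) atTop (𝓝 (0 * B)) :=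
    (tendsto_rpow_neg_atTop (by norm_num)).mul_const B
  have h3 := h1.atBot_add h2
  obtain ⟨τ, hτ, hτ0⟩ := ((h3.eventually (eventually_lt_atBot (y + 1))).and
    (eventually_gt_atTop 0)).exists
  exact ⟨τ, hτ0, by linarith⟩

variable {H : Type*} {D : H → Prop} {a b : H → ℝ}

lemma iInf_eq_bot_of_neg (hm : 0 < m) (hN : 0 < N)
    (hb : ∀ w, D w → 0 < b w)
    (hneg : (⨅ (w : H) (_ : D w), ((a w * b w ^ (m / N) : ℝ) : EReal)) < 0) :
    (⨅ (τ : ℝ) (_ : 0 < τ), ⨅ (w : H) (_ : D w),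
      ((τ ^ (m / (2 * N)) * a w + τ ^ (-(1 / 2) : ℝ) * b w - 1 : ℝ) : EReal)) = ⊥ := by
  obtain ⟨w, hw⟩ := iInf_lt_iff.1 hneg
  obtain ⟨hD, hw⟩ := iInf_lt_iff.1 hw
  have ha : a w < 0 := by
    by_contra! h
    have := mul_nonneg h (Real.rpow_nonneg (hb w hD).le (m / N))
    exact absurd hw (not_lt.2 (by exact_mod_cast this))
  rw [EReal.eq_bot_iff_forall_lt]
  intro y
  obtain ⟨τ, hτ, hlt⟩ := exists_lt_of_neg hm hN ha (b w) y
  exact ((iInf₂_le τ hτ).trans (iInf₂_le w hD)).trans_lt (by exact_mod_cast hlt)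

/-- The lower bound is monotonicity of `minValue` applied to each `w`. The upper bound uses its
continuity at `l`, since the infimum over `w` need not be attained. -/
lemma iInf_eq_minValue (hm : 0 < m) (hN : 0 < N) (hD : ∃ w, D w)
    (hb : ∀ w, D w → 0 < b w)
    (hnonneg : 0 ≤ ⨅ (w : H) (_ : D w), ((a w * b w ^ (m / N) : ℝ) : EReal)) :
    ∃ l : ℝ, 0 ≤ l ∧ (⨅ (w : H) (_ : D w), ((a w * b w ^ (m / N) : ℝ) : EReal)) = l ∧
      (∀ w, D w → 0 ≤ a w) ∧
      (⨅ (τ : ℝ) (_ : 0 < τ), ⨅ (w : H) (_ : D w),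
        ((τ ^ (m / (2 * N)) * a w + τ ^ (-(1 / 2) : ℝ) * b w - 1 : ℝ) : EReal)) =
        (minValue m N l : ℝ) := by
  obtain ⟨w₀, hw₀⟩ := hD
  set Λ := ⨅ (w : H) (_ : D w), ((a w * b w ^ (m / N) : ℝ) : EReal) with hΛ
  have htop : Λ ≠ ⊤ := ((iInf₂_le w₀ hw₀).trans_lt (EReal.coe_lt_top _)).ne
  have hbot : Λ ≠ ⊥ := (EReal.bot_lt_zero.trans_le hnonneg).ne'
  obtain ⟨l, hl⟩ : ∃ l : ℝ, Λ = l := ⟨Λ.toReal, (EReal.coe_toReal htop hbot).symm⟩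
  have hl0 : 0 ≤ l := by rw [hl] at hnonneg; exact_mod_cast hnonneg
  have hge : ∀ w, D w → l ≤ a w * b w ^ (m / N) := fun w hw => by
    have : Λ ≤ _ := iInf₂_le w hw
    rw [hl] at this
    exact_mod_cast this
  have ha : ∀ w, D w → 0 ≤ a w := fun w hw =>
    nonneg_of_mul_nonneg_left (hl0.trans (hge w hw)) (Real.rpow_pos_of_pos (hb w hw) _)
  refine ⟨l, hl0, hl, ha, le_antisymm ?_ ?_⟩
  · refine le_of_forall_gt fun y hy => ?_
    induction y with
    | bot => exact absurd hy not_lt_bot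
    | top =>
      exact ((iInf₂_le 1 one_pos).trans (iInf₂_le w₀ hw₀)).trans_lt (EReal.coe_lt_top _)
    | coe y =>
      have hy' : minValue m N l < y := by exact_mod_cast hy
      -- Some `x > l` still has `minValue` below `y`; since `x` exceeds the infimum, some admissible
      -- `w` has a smaller quotient.
      have hev := (continuous_minValue hm hN).continuousAt.eventually (gt_mem_nhds hy')
      obtain ⟨x, hxy, hlx⟩ := ((hev.filter_mono nhdsWithin_le_nhds).and
        (self_mem_nhdsWithin (s := Ioi l))).exists
      have hΛx : Λ < x := by rw [hl]; exact_mod_cast hlx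
      obtain ⟨w, hw⟩ := iInf_lt_iff.1 hΛx
      obtain ⟨hDw, hw⟩ := iInf_lt_iff.1 hw
      have hw' : a w * b w ^ (m / N) < x := by exact_mod_cast hw
      have hlt := (strictMonoOn_minValue hm hN).monotoneOn (hl0.trans (hge w hDw))
        (hl0.trans hlx.le) hw'.le
      obtain ⟨τ, hτ, h⟩ := exists_lt_of_minValue_lt hm hN (ha w hDw) (hb w hDw) (hlt.trans_lt hxy)
      exact ((iInf₂_le τ hτ).trans (iInf₂_le w hDw)).trans_lt (by exact_mod_cast h)
  · refine le_iInf₂ fun τ hτ => le_iInf₂ fun w hw => ?_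
    have h1 := (strictMonoOn_minValue hm hN).monotoneOn hl0 (hl0.trans (hge w hw)) (hge w hw)
    exact_mod_cast h1.trans (minValue_le hm hN (ha w hw) (hb w hw) hτ)

end Minimization

/-! ### Gradients of constants and of multiples. -/

section Gradient

variable {n : ℕ} [NeZero n] {M : Type*} [TopologicalSpace M]
  [ChartedSpace (EuclideanHalfSpace n) M] [IsManifold (𝓡∂ n) ∞ M]

lemma eq_zero_of_inner_self (g : Metric n M) {p : M} {Y : TangentSpace (𝓡∂ n) p}
    (h : g.inner p Y Y = 0) : Y = 0 := by
  by_contra h0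
  exact (g.pos p Y h0).ne' h

lemma gradient_const (g : Metric n M) (c : ℝ) (p : M) :
    gradient g (fun _ => c) p = 0 := by
  refine eq_zero_of_inner_self g ?_
  rw [inner_gradient, diff, mfderiv_const]
  rfl

lemma diff_const_mul {u : M → ℝ} (hu : IsSmooth n u) (c : ℝ) (p : M)
    (Y : TangentSpace (𝓡∂ n) p) :
    diff (n := n) (fun p => c * u p) p Y = c * diff (n := n) u p Y := by
  have h := const_smul_mfderiv (I := 𝓡∂ n) (hu.mdifferentiable (by simp) p) c
  exact congrArg (fun L : TangentSpace (𝓡∂ n) p →L[ℝ] ℝ => L Y) h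

lemma gradient_const_mul (g : Metric n M) {u : M → ℝ} (hu : IsSmooth n u) (c : ℝ) (p : M) :
    gradient g (fun p => c * u p) p = c • gradient g u p := by
  refine sub_eq_zero.1 (eq_zero_of_inner_self g ?_)
  rw [map_sub (g.inner p), map_smul (g.inner p)]
  simp only [sub_apply, smul_apply, smul_eq_mul, inner_gradient, diff_const_mul hu, sub_self]

lemma normSq_smul (g : Metric n M) (p : M) (c : ℝ) (Y : TangentSpace (𝓡∂ n) p) :
    normSq g p (c • Y) = c ^ 2 * normSq g p Y := by
  simp only [normSq, map_smul, smul_apply, smul_eq_mul]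
  ring

end Gradient

/-! ### Homogeneity of the functionals and reduction to normalized functions. -/

namespace SmoothMMS

variable {n : ℕ} [NeZero n] {M : Type*} [TopologicalSpace M]
  [ChartedSpace (EuclideanHalfSpace n) M] [IsManifold (𝓡∂ n) ∞ M]
  [MeasurableSpace M] [BorelSpace M] [T2Space M] [CompactSpace M]

/-- The constant function `1` as an element of `H¹`. -/
def H1.one (X : SmoothMMS n M) : X.H1 where
  w := fun _ => 1
  grad := fun _ => 0
  trace := fun _ => 1
  memLp := memLp_const 1
  memLp_trace := memLp_const 1
  grad_meas f _ := by
    have : (fun p => diff (n := n) f p 0) = fun _ => (0 : ℝ) := by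
      ext p
      exact map_zero (mfderiv (𝓡∂ n) 𝓘(ℝ, ℝ) f p)
    rw [this]
    exact aestronglyMeasurable_const
  exists_approx := by
    refine ⟨fun _ _ => 1, fun _ => contMDiff_const, ?_, ?_, ?_⟩
    · simp
    · simp [gradient_const, normSq]
    · simp

/-- A multiple of an element of `H¹`. -/
def H1.constMul {X : SmoothMMS n M} (c : ℝ) (w : X.H1) : X.H1 where
  w := fun p => c * w.w p
  grad := fun p => c • w.grad p
  trace := fun p => c * w.trace p
  memLp := w.memLp.const_mul c
  memLp_trace := w.memLp_trace.const_mul c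
  grad_meas f hf := by
    have : (fun p => diff (n := n) f p (c • w.grad p)) =
        fun p => c * diff (n := n) f p (w.grad p) := by
      ext p
      exact map_smul (mfderiv (𝓡∂ n) 𝓘(ℝ, ℝ) f p) c (w.grad p)
    rw [this]
    exact (w.grad_meas f hf).const_mul c
  exists_approx := by
    obtain ⟨u, hu, h1, h2, h3⟩ := w.exists_approx
    have hscale : ∀ {μ : Measure M} {t : M → ℝ},
        Tendsto (fun k => eLpNorm (fun p => u k p - t p) 2 μ) atTop (𝓝 0) →
        Tendsto (fun k => eLpNorm (fun p => c * u k p - c * t p) 2 μ) atTop (𝓝 0) := by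
      intro μ t h
      have h' := ENNReal.Tendsto.const_mul (a := ‖c‖ₑ) h (Or.inr enorm_ne_top)
      rw [mul_zero] at h'
      refine h'.congr fun k => ?_
      rw [← eLpNorm_const_smul]
      congr 1
      ext p
      simp [mul_sub]
    refine ⟨fun k p => c * u k p, fun k => contMDiff_const.mul (hu k), hscale h1, ?_, hscale h3⟩
    have h' := ENNReal.Tendsto.const_mul (a := ENNReal.ofReal (c ^ 2)) h2
      (Or.inr ENNReal.ofReal_ne_top)
    rw [mul_zero] at h'
    refine h'.congr fun k => ?_
    rw [← lintegral_const_mul' _ _ ENNReal.ofReal_ne_top]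
    refine lintegral_congr fun p => ?_
    rw [gradient_const_mul X.g (hu k), ← smul_sub, normSq_smul, ENNReal.ofReal_mul (sq_nonneg c)]

lemma energyForm_constMul (X : SmoothMMS n M) (c : ℝ) (w : X.H1) :
    X.energyForm (w.constMul c) = c ^ 2 * X.energyForm w := by
  simp only [energyForm, H1.constMul, normSq_smul, mul_pow]
  rw [mul_add, ← integral_const_mul, ← integral_const_mul]
  congr 2
  · ext p; ring
  · ext p; ring

lemma interiorInt_constMul (X : SmoothMMS n M) {c : ℝ} (hc : 0 ≤ c) (w : X.H1) :
    X.interiorInt (w.constMul c) = c ^ X.crit * X.interiorInt w := by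
  simp only [interiorInt, H1.constMul, abs_mul, abs_of_nonneg hc]
  rw [← integral_const_mul]
  congr 1
  ext p
  rw [Real.mul_rpow hc (abs_nonneg _), mul_assoc]

lemma boundaryInt_constMul (X : SmoothMMS n M) {c : ℝ} (hc : 0 ≤ c) (w : X.H1) :
    X.boundaryInt (w.constMul c) = c ^ X.crit * X.boundaryInt w := by
  simp only [boundaryInt, H1.constMul, abs_mul, abs_of_nonneg hc]
  rw [← integral_const_mul]
  congr 1
  ext p
  rw [Real.mul_rpow hc (abs_nonneg _)]

lemma boundaryInt_nonneg (X : SmoothMMS n M) (w : X.H1) : 0 ≤ X.boundaryInt w :=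
  integral_nonneg fun _ => Real.rpow_nonneg (abs_nonneg _) _

lemma v_pos (X : SmoothMMS n M) (p : M) : 0 < X.v p := Real.exp_pos _

lemma interiorInt_nonneg (X : SmoothMMS n M) (w : X.H1) : 0 ≤ X.interiorInt w :=
  integral_nonneg fun p => mul_nonneg (Real.rpow_nonneg (abs_nonneg _) _) (inv_nonneg.2 (X.v_pos p).le)

lemma continuous_v (X : SmoothMMS n M) : Continuous X.v :=
  Real.continuous_exp.comp (X.continuous_φ.neg.div_const _)

lemma boundaryInt_one_ne_zero (X : SmoothMMS n M) (hbd : ((𝓡∂ n).boundary M).Nonempty) :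
    X.boundaryInt (H1.one X) ≠ 0 := by
  simp only [boundaryInt, H1.one, abs_one, Real.one_rpow, integral_const, smul_eq_mul, mul_one]
  exact (measureReal_ne_zero_iff (by simp)).2 (by simpa using X.area_ne_zero hbd)

/-- Since `v` is positive, a zero interior integral makes `w` vanish almost everywhere, and then its
trace vanishes too, against the hypothesis on the boundary integral. -/
lemma interiorInt_pos (X : SmoothMMS n M) (hcrit : 0 < X.crit) (w : X.H1)
    (hS : X.boundaryInt w ≠ 0) : 0 < X.interiorInt w := by
  refine lt_of_le_of_ne (X.interiorInt_nonneg w) fun h0 => hS ?_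
  have hint : Integrable (fun p => |w.w p| ^ X.crit * (X.v p)⁻¹) X.vol := by
    have h1 : Integrable (fun p => |w.w p| ^ X.crit) X.vol := by
      have := w.memLp.integrable_norm_rpow (by simpa using hcrit) (by simp)
      rwa [ENNReal.toReal_ofReal hcrit.le] at this
    obtain ⟨C, -, hC⟩ := exists_bound_of_continuousOn isCompact_univ subset_rfl
      (X.continuous_v.inv₀ fun p => (X.v_pos p).ne').continuousOn
    exact h1.mul_bdd (c := C) (X.continuous_v.inv₀ fun p => (X.v_pos p).ne').aestronglyMeasurable
      (.of_forall fun p => hC p (mem_univ p))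
  have hae := (integral_eq_zero_iff_of_nonneg
    (fun p => mul_nonneg (Real.rpow_nonneg (abs_nonneg _) _) (inv_nonneg.2 (X.v_pos p).le))
    hint).1 h0.symm
  have hw : w.w =ᵐ[X.vol] 0 := by
    filter_upwards [hae] with p hp
    have h1 : |w.w p| ^ X.crit = 0 := by
      simpa [(X.v_pos p).ne'] using hp
    simpa using (Real.rpow_eq_zero (abs_nonneg _) hcrit.ne').1 h1
  have htr := w.trace_ae_eq_zero hw
  rw [boundaryInt, integral_eq_zero_of_ae]
  filter_upwards [htr] with p hp
  simp [hp, Real.zero_rpow hcrit.ne']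

lemma exists_normalized (X : SmoothMMS n M) (hcrit : 0 < X.crit) (w : X.H1)
    (hS : X.boundaryInt w ≠ 0) :
    ∃ c : ℝ, 0 < c ∧ X.boundaryInt (w.constMul c) = 1 := by
  have hpos : 0 < X.boundaryInt w := lt_of_le_of_ne (X.boundaryInt_nonneg w) hS.symm
  -- The boundary integral is homogeneous of degree `crit`, which dictates this scaling factor.
  refine ⟨X.boundaryInt w ^ (-X.crit⁻¹), Real.rpow_pos_of_pos hpos _, ?_⟩
  rw [X.boundaryInt_constMul (Real.rpow_nonneg hpos.le _), ← Real.rpow_mul hpos.le]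
  have : -X.crit⁻¹ * X.crit = -1 := by field_simp
  rw [this, Real.rpow_neg_one, inv_mul_cancel₀ hS]

lemma quotient_constMul (X : SmoothMMS n M) (hN : 0 < X.m + n - 2) {c : ℝ} (hc : 0 < c) (w : X.H1) :
    X.quotient (w.constMul c) = X.quotient w := by
  have hcp : 0 ≤ c ^ X.crit := Real.rpow_nonneg hc.le _
  have hN1 : 0 < X.m + n - 1 := by linarith
  simp only [quotient]
  rw [energyForm_constMul, interiorInt_constMul _ hc.le, boundaryInt_constMul _ hc.le,
    Real.mul_rpow hcp (X.interiorInt_nonneg w), Real.mul_rpow hcp (X.boundaryInt_nonneg w),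
    ← Real.rpow_mul hc.le, ← Real.rpow_mul hc.le]
  -- With p = `crit`, the degrees agree because (2m + n - 2) - m = m + n - 2 and p (m + n - 2)/(m +
  -- n - 1) = 2.
  have hexp : c ^ (X.crit * ((2 * X.m + n - 2) / (X.m + n - 1))) =
      c ^ 2 * c ^ (X.crit * (X.m / (X.m + n - 1))) := by
    rw [← Real.rpow_natCast, ← Real.rpow_add hc]
    congr 1
    rw [crit]
    field_simp
    push_cast
    ring
  rw [hexp]
  have h1 : c ^ 2 * c ^ (X.crit * (X.m / (X.m + n - 1))) ≠ 0 := by positivity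
  rw [mul_mul_mul_comm, mul_div_mul_left _ _ h1]

lemma quotient_of_boundaryInt_eq_one (X : SmoothMMS n M) {w : X.H1} (hw : X.boundaryInt w = 1) :
    X.quotient w = X.energyForm w * X.interiorInt w ^ (X.m / (X.m + n - 1)) := by
  rw [quotient, hw, Real.one_rpow, div_one]

lemma escobarConstant_eq (X : SmoothMMS n M) (hN : 0 < X.m + n - 2) :
    X.escobarConstant = ⨅ (w : X.H1) (_ : X.boundaryInt w = 1),
      ((X.energyForm w * X.interiorInt w ^ (X.m / (X.m + n - 1)) : ℝ) : EReal) := by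
  have hcrit : 0 < X.crit := div_pos (by linarith) hN
  refine le_antisymm (le_iInf₂ fun w hw => ?_) (le_iInf₂ fun w hw => ?_)
  · rw [← X.quotient_of_boundaryInt_eq_one hw]
    exact iInf₂_le w (by rw [hw]; exact one_ne_zero)
  · obtain ⟨c, hc, h1⟩ := X.exists_normalized hcrit w hw
    rw [← X.quotient_constMul hN hc, X.quotient_of_boundaryInt_eq_one h1]
    exact iInf₂_le (w.constMul c) h1

lemma WFunctional_of_boundaryInt_eq_one (X : SmoothMMS n M) {w : X.H1} (hw : X.boundaryInt w = 1)
    (τ : ℝ) : X.WFunctional w τ = τ ^ (X.m / (2 * (X.m + n - 1))) * X.energyForm w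
      + τ ^ (-(1 / 2) : ℝ) * X.interiorInt w - 1 := by
  rw [WFunctional, hw]

lemma energy_eq (X : SmoothMMS n M) :
    X.energy = ⨅ (τ : ℝ) (_ : 0 < τ), ⨅ (w : X.H1) (_ : X.boundaryInt w = 1),
      ((τ ^ (X.m / (2 * (X.m + n - 1))) * X.energyForm w
        + τ ^ (-(1 / 2) : ℝ) * X.interiorInt w - 1 : ℝ) : EReal) := by
  simp only [energy, tauEnergy]
  refine iInf_congr fun τ => iInf_congr fun _ => iInf_congr fun w => iInf_congr fun hw => ?_
  rw [X.WFunctional_of_boundaryInt_eq_one hw]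

lemma optimalTau_eq (X : SmoothMMS n M) (w : X.H1) :
    X.optimalTau w = minPoint X.m (X.m + n - 1) (X.energyForm w) (X.interiorInt w) := by
  rw [optimalTau, minPoint, show X.m + n - 1 + X.m = 2 * X.m + n - 1 by ring]

end SmoothMMS

end EscobarWeighted

end

/-! ### The trichotomy, the formula for the energy and the minimizers. -/

open EscobarWeighted

theorem mainTheorem5 {n : ℕ} [NeZero n] (hn : 2 ≤ n)
    {M : Type*} [TopologicalSpace M] [T2Space M] [CompactSpace M]
    [ChartedSpace (EuclideanHalfSpace n) M] [IsManifold (𝓡∂ n) ∞ M]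
    [MeasurableSpace M] [BorelSpace M]
    (hbd : ((𝓡∂ n).boundary M).Nonempty)
    (X : EscobarWeighted.SmoothMMS n M) (hm : 0 < X.m) :
    (X.escobarConstant < 0 ↔ X.energy = ⊥) ∧
    (X.escobarConstant = 0 ↔ X.energy = ((-1 : ℝ) : EReal)) ∧
    (0 < X.escobarConstant ↔ ((-1 : ℝ) : EReal) < X.energy) ∧
    (0 < X.escobarConstant →
      (∃ Λ : ℝ, X.escobarConstant = (Λ : EReal) ∧
        X.energy = (((2 * X.m + n - 1) / X.m *
          (X.m * Λ / (X.m + n - 1)) ^ ((X.m + n - 1) / (2 * X.m + n - 1)) - 1 : ℝ) : EReal)) ∧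
      (∀ w : X.H1, X.IsEscobarMinimizer w ↔ X.IsEnergyMinimizer w (X.optimalTau w)) ∧
      (∀ (w : X.H1) (τ : ℝ), X.IsEnergyMinimizer w τ → τ = X.optimalTau w)) := by
  have hn' : (2 : ℝ) ≤ n := by exact_mod_cast hn
  have hN2 : 0 < X.m + n - 2 := by linarith
  have hN : 0 < X.m + n - 1 := by linarith
  have hcrit : 0 < X.crit := div_pos (by linarith) hN2
  have hB : ∀ w : X.H1, X.boundaryInt w = 1 → 0 < X.interiorInt w :=
    fun w hw => X.interiorInt_pos hcrit w (by rw [hw]; exact one_ne_zero)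
  have hD : ∃ w : X.H1, X.boundaryInt w = 1 := by
    obtain ⟨c, -, h⟩ := X.exists_normalized hcrit _ (X.boundaryInt_one_ne_zero hbd)
    exact ⟨_, h⟩
  have hneg : X.escobarConstant < 0 → X.energy = ⊥ := by
    rw [X.escobarConstant_eq hN2, X.energy_eq]
    exact iInf_eq_bot_of_neg hm hN hB
  have hpos : 0 ≤ X.escobarConstant → ∃ l : ℝ, 0 ≤ l ∧ X.escobarConstant = l ∧
      (∀ w, X.boundaryInt w = 1 → 0 ≤ X.energyForm w) ∧
      X.energy = (minValue X.m (X.m + n - 1) l : ℝ) := by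
    rw [X.escobarConstant_eq hN2, X.energy_eq]
    exact iInf_eq_minValue hm hN hD hB
  have hmono := strictMonoOn_minValue hm hN
  have hzero : minValue X.m (X.m + n - 1) 0 = -1 := minValue_zero hN hm
  have hgt : ∀ l : ℝ, 0 < l → -1 < minValue X.m (X.m + n - 1) l := fun l hl => by
    rw [← hzero]
    exact hmono self_mem_Ici hl.le hl
  have h1 : X.escobarConstant = 0 → X.energy = ((-1 : ℝ) : EReal) := by
    intro h
    obtain ⟨l, -, hl, -, hE⟩ := hpos h.ge
    have : l = 0 := by rw [h] at hl; exact_mod_cast hl.symm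
    rw [hE, this, hzero]
  have h2 : 0 < X.escobarConstant → ((-1 : ℝ) : EReal) < X.energy := by
    intro h
    obtain ⟨l, -, hl, -, hE⟩ := hpos h.le
    rw [hE]
    exact_mod_cast hgt l (by rw [hl] at h; exact_mod_cast h)
  refine ⟨⟨hneg, fun h => ?_⟩, ⟨h1, fun h => ?_⟩, ⟨h2, fun h => ?_⟩, fun hΛ => ?_⟩
  -- When the Escobar constant is nonnegative the energy is a real number, hence not `⊥`.
  · by_contra! h0
    obtain ⟨l, -, -, -, hE⟩ := hpos h0
    rw [h] at hE
    exact EReal.bot_ne_coe _ hE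
  · rcases lt_trichotomy X.escobarConstant 0 with h0 | h0 | h0
    · rw [hneg h0] at h
      exact absurd h (EReal.bot_ne_coe _)
    · exact h0
    · exact absurd h (h2 h0).ne'
  · rcases lt_trichotomy X.escobarConstant 0 with h0 | h0 | h0
    · rw [hneg h0] at h
      exact absurd h not_lt_bot
    · exact absurd h (by rw [h1 h0]; exact lt_irrefl _)
    · exact h0
  obtain ⟨l, hl0, hl, hA, hE⟩ := hpos hΛ.le
  have hlpos : 0 < l := by rw [hl] at hΛ; exact_mod_cast hΛ
  have hle : ∀ w, X.boundaryInt w = 1 →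
      l ≤ X.energyForm w * X.interiorInt w ^ (X.m / (X.m + n - 1)) := fun w hw => by
    have h : X.escobarConstant ≤ _ := iInf₂_le w (by rw [hw]; exact one_ne_zero)
    rw [hl, X.quotient_of_boundaryInt_eq_one hw] at h
    exact_mod_cast h
  -- Positivity of the Escobar constant excludes the degenerate case of zero energy, so each
  -- normalized `w` has a unique optimal τ.
  have hApos : ∀ w, X.boundaryInt w = 1 → 0 < X.energyForm w := fun w hw =>
    pos_of_mul_pos_left (hlpos.trans_le (hle w hw)) (Real.rpow_nonneg (hB w hw).le _)
  have huniq : ∀ (w : X.H1) (τ : ℝ), X.IsEnergyMinimizer w τ →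
      τ = X.optimalTau w ∧ X.IsEscobarMinimizer w := by
    rintro w τ ⟨hτ, hw, hmin⟩
    rw [hE, X.WFunctional_of_boundaryInt_eq_one hw, EReal.coe_eq_coe_iff] at hmin
    have hmon := hmono.monotoneOn hl0 (hl0.trans (hle w hw)) (hle w hw)
    have hτeq : τ = X.optimalTau w := by
      by_contra hne
      rw [X.optimalTau_eq] at hne
      -- At any other τ the value strictly exceeds `minValue` at the quotient of `w`, which is at
      -- least `minValue` at `l`, the energy.
      have := minValue_lt hm hN (hApos w hw) (hB w hw) hτ hne
      linarith
    refine ⟨hτeq, hw, ?_⟩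
    have hval := minPoint_value hm hN (hApos w hw) (hB w hw)
    rw [← X.optimalTau_eq, ← hτeq, hmin] at hval
    rw [hl, X.quotient_of_boundaryInt_eq_one hw, EReal.coe_eq_coe_iff]
    -- At the optimal τ, minimality makes `minValue` agree at `l` and at the quotient of `w`;
    -- injectivity identifies the two.
    exact (hmono.injOn hl0 (hl0.trans (hle w hw)) hval).symm
  refine ⟨⟨l, hl, ?_⟩, fun w => ⟨fun h => ?_, fun h => (huniq w _ h).2⟩,
    fun w τ h => (huniq w τ h).1⟩
  · rw [hE, minValue, show X.m + n - 1 + X.m = 2 * X.m + n - 1 by ring]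
  · obtain ⟨hw, hq⟩ := h
    rw [hl, X.quotient_of_boundaryInt_eq_one hw, EReal.coe_eq_coe_iff] at hq
    refine ⟨?_, hw, ?_⟩
    · rw [X.optimalTau_eq]
      exact minPoint_pos hm hN (hApos w hw) (hB w hw)
    · rw [hE, X.WFunctional_of_boundaryInt_eq_one hw, X.optimalTau_eq,
        minPoint_value hm hN (hApos w hw) (hB w hw), hq]
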